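/- Let $\mu$ be a positive Radon measure on $\mathbb R$ without atoms such that $\mu((-\infty,a))=\mu([a,+\infty))=\infty$ for every $a\in\mathbb R$. Fix $x_0\in\mathbb R$. For $r>0$ let $I_i^r=[a_i^r,a_{i+1}^r)$, $i\in\mathbb Z$, be a partition of $\mathbb R$ into intervals with $a_0^r=x_0$ and $\mu(I_i^r)=r$ (it is unique up to $\mu$-null sets). For $q,p,\alpha\in[1,\infty]$ put $$ {}_r\|f\|_{q,p}=\Big(\sum_{i\in\mathbb Z}\|f\chi_{I_i^r}\|_{L^q(\mu)}^p\Big)^{1/p}\ \ (\text{supremum over } i \text{ if } p=\infty),\qquad \|f\|_{q,p,\alpha}=\sup_{r>0} r^{\frac1\alpha-\frac1q}\ {}_r\|f\|_{q,p}.$$ Let $q,\alpha,\beta,q_1,\alpha_1,p_1\in[1,\infty]$ with $$q\le\alpha\le\beta<\infty,\qquad q\le q_1\le\alpha_1\le p_1,\qquad 0<\frac1\theta=\frac1{q_1}-\frac1\beta ,$$ and let $\frac1\eta=1-\frac1\beta$. Assume: * there is a constant $C_3$ such that $$\limsup_{r\to\infty}\ \sup_{t\in\mathbb R}\frac{\mu([t,t+r])}{\mu([0,r])}\le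 C_3,\qquad \limsup_{r\to\infty}\ \sup_{t\in\mathbb R}\frac{\mu([t-r,t])}{\mu([-r,0])}\le C_3;$$ * $k:\mathbb R\to[0,\infty]$ is even, lower semicontinuous, non-increasing on $(0,\infty)$, and $\sup_{x}\|k(x-\cdot)\|^*_{\eta,\infty}<\infty$, $\sup_{y}\|k(\cdot-y)\|^*_{\eta,\infty}<\infty$, where $\|g\|^*_{\eta,\infty}=\sup_{\lambda>0}\lambda\,\mu(\{|g|>\lambda\})^{1/\eta}$; * $v:\mathbb R\to[0,\infty)$ is measurable and there is a constant $C_4$ such that for every interval $I$ with $0<\mu(I)<\infty$ $$\Big(\frac1{\mu(I)}\int_I v^\theta d\mu\Big)^{\frac1\theta}\Big(\frac1{\mu(I)}\int_I v^{-\frac{q_1q}{q_1-q}}d\mu\Big)^{\frac{q_1-q}{q_1q}}\le C_4\quad\text{if } q<q_1,$$ $$\Big(\frac1{\mu(I)}\int_I v^\theta d\mu\Big)^{\frac1\theta}\,\|v^{-1}\chi_I\|_{L^\infty(\mu)}\le C_4\quad\text{if } q=q_1.$$ For measurable $f\ge0$ let $Kf(x)=\int_{\mathbb R}k(x-y)f(y)\,d\mu(y)\in[0,\infty]$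 and $F_\lambda=\{x\in\mathbb R: Kf(x)>\lambda\}$. Then there is a constant $C$ such that for every measurable $f:\mathbb R\to[0,\infty)$ and every $\lambda\in(0,\infty)$: 1. $\displaystyle\Big(\int_{F_\lambda}v^\theta\,d\mu\Big)^{1/\theta}\le C\,\lambda^{-1}\Big(\int_{\mathbb R}|fv|^{q_1}\,d\mu\Big)^{1/q_1}$; 2. if $\alpha<\beta$ and $\frac1\theta\le\frac1{p_1}$, then, with $\frac1s=\frac1\alpha-\frac1\beta$, $$\Big(\int_{F_\lambda}v^\theta\,d\mu\Big)^{1/\theta}\le C\,\big(\lambda^{-1}\|fv\|_{q_1,p_1,\alpha_1}\big)\big(\lambda^{-1}\|f\|_{q,\infty,\alpha}\big)^{s\left(\frac1{q_1}-\frac1{\alpha_1}\right)} .$$ -/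

import Mathlib

open MeasureTheory Set Filter
open scoped ENNReal NNReal Topology

noncomputable section

namespace Amalgam

/-- The cut points `a_i` (`i ∈ ℤ`) of the line at `μ`-step `r`, starting at `a_0 = x₀`: for `i ≥ 0`,
`a_i` is the first `b ≥ x₀` with `μ [x₀, b) ≥ i r`, and for `i < 0` it is the last `b ≤ x₀` with
`μ [b, x₀) ≥ |i| r`. -/
def cutPoint (μ : Measure ℝ) (x₀ r : ℝ) (i : ℤ) : ℝ :=
  if 0 ≤ i then sInf {b : ℝ | x₀ ≤ b ∧ ENNReal.ofReal (i * r) ≤ μ (Ico x₀ b)}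
  else sSup {b : ℝ | b ≤ x₀ ∧ ENNReal.ofReal (-i * r) ≤ μ (Ico b x₀)}

/-- The interval `I_i^r = [a_i, a_{i+1})` of `μ`-measure `r`. -/
def cell (μ : Measure ℝ) (x₀ r : ℝ) (i : ℤ) : Set ℝ :=
  Ico (cutPoint μ x₀ r i) (cutPoint μ x₀ r (i + 1))

theorem measure_Ico_sInf (μ : Measure ℝ) [IsLocallyFiniteMeasure μ] [NullSingletonClass μ]
    (x₀ : ℝ) (h : μ (Ici x₀) = ∞) (c : ℝ) :
    x₀ ≤ sInf {b : ℝ | x₀ ≤ b ∧ ENNReal.ofReal c ≤ μ (Ico x₀ b)} ∧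
    μ (Ico x₀ (sInf {b : ℝ | x₀ ≤ b ∧ ENNReal.ofReal c ≤ μ (Ico x₀ b)})) = ENNReal.ofReal c := by
  set S := {b : ℝ | x₀ ≤ b ∧ ENNReal.ofReal c ≤ μ (Ico x₀ b)} with hS
  have hbdd : BddBelow S := ⟨x₀, fun b hb => hb.1⟩
  have hne : S.Nonempty := by
    have hU : (⋃ n : ℕ, Ico x₀ (x₀ + n)) = Ici x₀ := by
      ext y
      simp only [mem_iUnion, mem_Ico, mem_Ici]
      refine ⟨fun ⟨n, hn⟩ => hn.1, fun hy => ?_⟩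
      obtain ⟨n, hn⟩ := exists_nat_gt (y - x₀)
      exact ⟨n, hy, by linarith⟩
    have hmono : Monotone (fun n : ℕ => Ico x₀ (x₀ + n)) := fun m n hmn =>
      Ico_subset_Ico_right (by have : (m : ℝ) ≤ n := by exact_mod_cast hmn
                               linarith)
    have ht := tendsto_measure_iUnion_atTop (μ := μ) hmono
    rw [hU, h] at ht
    obtain ⟨n, hn⟩ := (ht.eventually (lt_mem_nhds (ENNReal.ofReal_lt_top (r := c)))).exists
    exact ⟨x₀ + n, by simp, hn.le⟩
  have hx : x₀ ≤ sInf S := le_csInf hne fun b hb => hb.1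
  refine ⟨hx, le_antisymm ?_ ?_⟩
  · have hU : (⋃ n : ℕ, Ico x₀ (sInf S - 1 / ((n : ℝ) + 1))) = Ico x₀ (sInf S) := by
      ext y
      simp only [mem_iUnion, mem_Ico]
      constructor
      · rintro ⟨n, h1, h2⟩
        have : 0 < 1 / ((n : ℝ) + 1) := by positivity
        exact ⟨h1, by linarith⟩
      · rintro ⟨h1, h2⟩
        obtain ⟨n, hn⟩ := exists_nat_one_div_lt (sub_pos.2 h2)
        exact ⟨n, h1, by linarith⟩
    have hmono : Monotone (fun n : ℕ => Ico x₀ (sInf S - 1 / ((n : ℝ) + 1))) := fun m n hmn =>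
      Ico_subset_Ico_right (by
        have := Nat.one_div_le_one_div (α := ℝ) hmn
        linarith)
    have ht := tendsto_measure_iUnion_atTop (μ := μ) hmono
    rw [hU] at ht
    refine le_of_tendsto' ht fun n => ?_
    by_contra hcon
    push Not at hcon
    have hpos : 0 < 1 / ((n : ℝ) + 1) := by positivity
    have hx0 : x₀ ≤ sInf S - 1 / ((n : ℝ) + 1) := by
      by_contra hlt
      push Not at hlt
      rw [Function.comp_apply, Ico_eq_empty_of_le hlt.le] at hcon
      simp at hcon
    have := csInf_le hbdd (show sInf S - 1 / ((n : ℝ) + 1) ∈ S from ⟨hx0, hcon.le⟩)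
    linarith
  · have hI : (⋂ n : ℕ, Icc x₀ (sInf S + 1 / ((n : ℝ) + 1))) = Icc x₀ (sInf S) := by
      ext y
      simp only [mem_iInter, mem_Icc]
      constructor
      · intro hy
        refine ⟨(hy 0).1, ?_⟩
        by_contra hlt
        push Not at hlt
        obtain ⟨n, hn⟩ := exists_nat_one_div_lt (sub_pos.2 hlt)
        have := (hy n).2
        linarith
      · rintro ⟨h1, h2⟩ n
        have : 0 < 1 / ((n : ℝ) + 1) := by positivity
        exact ⟨h1, by linarith⟩
    have hanti : Antitone (fun n : ℕ => Icc x₀ (sInf S + 1 / ((n : ℝ) + 1))) := fun m n hmn =>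
      Icc_subset_Icc_right (by
        have := Nat.one_div_le_one_div (α := ℝ) hmn
        linarith)
    have ht := tendsto_measure_iInter_atTop (μ := μ)
      (fun n : ℕ => (measurableSet_Icc (a := x₀)
        (b := sInf S + 1 / ((n : ℝ) + 1))).nullMeasurableSet) hanti
      ⟨0, measure_Icc_lt_top.ne⟩
    rw [hI] at ht
    rw [measure_congr (Ico_ae_eq_Icc (μ := μ))]
    refine ge_of_tendsto' ht fun n => ?_
    have hpos : 0 < 1 / ((n : ℝ) + 1) := by positivity
    obtain ⟨b, hb, hbn⟩ := exists_lt_of_csInf_lt hne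
      (show sInf S < sInf S + 1 / ((n : ℝ) + 1) by linarith)
    exact hb.2.trans (measure_mono (Ico_subset_Icc_self.trans (Icc_subset_Icc_right hbn.le)))

theorem measure_Ico_sSup (μ : Measure ℝ) [IsLocallyFiniteMeasure μ] [NullSingletonClass μ]
    (x₀ : ℝ) (h : μ (Iio x₀) = ∞) (c : ℝ) :
    sSup {b : ℝ | b ≤ x₀ ∧ ENNReal.ofReal c ≤ μ (Ico b x₀)} ≤ x₀ ∧
    μ (Ico (sSup {b : ℝ | b ≤ x₀ ∧ ENNReal.ofReal c ≤ μ (Ico b x₀)}) x₀) = ENNReal.ofReal c := by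
  set S := {b : ℝ | b ≤ x₀ ∧ ENNReal.ofReal c ≤ μ (Ico b x₀)} with hS
  have hbdd : BddAbove S := ⟨x₀, fun b hb => hb.1⟩
  have hne : S.Nonempty := by
    have hU : (⋃ n : ℕ, Ico (x₀ - n) x₀) = Iio x₀ := by
      ext y
      simp only [mem_iUnion, mem_Ico, mem_Iio]
      refine ⟨fun ⟨n, hn⟩ => hn.2, fun hy => ?_⟩
      obtain ⟨n, hn⟩ := exists_nat_gt (x₀ - y)
      exact ⟨n, by linarith, hy⟩
    have hmono : Monotone (fun n : ℕ => Ico (x₀ - n) x₀) := fun m n hmn =>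
      Ico_subset_Ico_left (by have : (m : ℝ) ≤ n := by exact_mod_cast hmn
                              linarith)
    have ht := tendsto_measure_iUnion_atTop (μ := μ) hmono
    rw [hU, h] at ht
    obtain ⟨n, hn⟩ := (ht.eventually (lt_mem_nhds (ENNReal.ofReal_lt_top (r := c)))).exists
    exact ⟨x₀ - n, by simp, hn.le⟩
  have hx : sSup S ≤ x₀ := csSup_le hne fun b hb => hb.1
  refine ⟨hx, le_antisymm ?_ ?_⟩
  · rw [measure_congr (Ioo_ae_eq_Ico (μ := μ)).symm]
    have hU : (⋃ n : ℕ, Ico (sSup S + 1 / ((n : ℝ) + 1)) x₀) = Ioo (sSup S) x₀ := by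
      ext y
      simp only [mem_iUnion, mem_Ico, mem_Ioo]
      constructor
      · rintro ⟨n, h1, h2⟩
        have : 0 < 1 / ((n : ℝ) + 1) := by positivity
        exact ⟨by linarith, h2⟩
      · rintro ⟨h1, h2⟩
        obtain ⟨n, hn⟩ := exists_nat_one_div_lt (sub_pos.2 h1)
        exact ⟨n, by linarith, h2⟩
    have hmono : Monotone (fun n : ℕ => Ico (sSup S + 1 / ((n : ℝ) + 1)) x₀) := fun m n hmn =>
      Ico_subset_Ico_left (by
        have := Nat.one_div_le_one_div (α := ℝ) hmn
        linarith)
    have ht := tendsto_measure_iUnion_atTop (μ := μ) hmono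
    rw [hU] at ht
    refine le_of_tendsto' ht fun n => ?_
    by_contra hcon
    push Not at hcon
    have hpos : 0 < 1 / ((n : ℝ) + 1) := by positivity
    have hx0 : sSup S + 1 / ((n : ℝ) + 1) ≤ x₀ := by
      by_contra hlt
      push Not at hlt
      rw [Function.comp_apply, Ico_eq_empty_of_le hlt.le] at hcon
      simp at hcon
    have := le_csSup hbdd (show sSup S + 1 / ((n : ℝ) + 1) ∈ S from ⟨hx0, hcon.le⟩)
    linarith
  · have hI : (⋂ n : ℕ, Ico (sSup S - 1 / ((n : ℝ) + 1)) x₀) = Ico (sSup S) x₀ := by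
      ext y
      simp only [mem_iInter, mem_Ico]
      constructor
      · intro hy
        refine ⟨?_, (hy 0).2⟩
        by_contra hlt
        push Not at hlt
        obtain ⟨n, hn⟩ := exists_nat_one_div_lt (sub_pos.2 hlt)
        have := (hy n).1
        linarith
      · rintro ⟨h1, h2⟩ n
        have : 0 < 1 / ((n : ℝ) + 1) := by positivity
        exact ⟨by linarith, h2⟩
    have hanti : Antitone (fun n : ℕ => Ico (sSup S - 1 / ((n : ℝ) + 1)) x₀) := fun m n hmn =>
      Ico_subset_Ico_left (by
        have := Nat.one_div_le_one_div (α := ℝ) hmn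
        linarith)
    have ht := tendsto_measure_iInter_atTop (μ := μ)
      (fun n : ℕ => (measurableSet_Ico (a := sSup S - 1 / ((n : ℝ) + 1))
        (b := x₀)).nullMeasurableSet) hanti
      ⟨0, measure_Ico_lt_top.ne⟩
    rw [hI] at ht
    refine ge_of_tendsto' ht fun n => ?_
    have hpos : 0 < 1 / ((n : ℝ) + 1) := by positivity
    obtain ⟨b, hb, hbn⟩ := exists_lt_of_lt_csSup hne
      (show sSup S - 1 / ((n : ℝ) + 1) < sSup S by linarith)
    exact hb.2.trans (measure_mono (Ico_subset_Ico_left hbn.le))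

/-- The cells start at `x₀`. -/
theorem cutPoint_zero (μ : Measure ℝ) (x₀ r : ℝ) : cutPoint μ x₀ r 0 = x₀ := by
  have : {b : ℝ | x₀ ≤ b ∧ ENNReal.ofReal (((0 : ℤ) : ℝ) * r) ≤ μ (Ico x₀ b)} = Ici x₀ := by
    ext b; simp
  simp only [cutPoint, le_refl, if_true, this, csInf_Ici]

/-- Each cell has measure `r`. -/
theorem measure_cell (μ : Measure ℝ) [IsLocallyFiniteMeasure μ] [NullSingletonClass μ]
    (hμ : ∀ a : ℝ, μ (Iio a) = ∞ ∧ μ (Ici a) = ∞) (x₀ r : ℝ) (hr : 0 < r) (i : ℤ) :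
    μ (cell μ x₀ r i) = ENNReal.ofReal r := by
  have hpos : ∀ j : ℤ, 0 ≤ j → x₀ ≤ cutPoint μ x₀ r j ∧
      μ (Ico x₀ (cutPoint μ x₀ r j)) = ENNReal.ofReal (j * r) := fun j hj => by
    simpa only [cutPoint, if_pos hj] using measure_Ico_sInf μ x₀ (hμ x₀).2 (j * r)
  have hneg : ∀ j : ℤ, j ≤ 0 → cutPoint μ x₀ r j ≤ x₀ ∧
      μ (Ico (cutPoint μ x₀ r j) x₀) = ENNReal.ofReal (-j * r) := fun j hj => by
    rcases hj.lt_or_eq with hj | rfl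
    · simpa only [cutPoint, if_neg hj.not_ge] using measure_Ico_sSup μ x₀ (hμ x₀).1 (-j * r)
    · simp [cutPoint_zero]
  unfold cell
  rcases le_or_gt 0 i with hi | hi
  · obtain ⟨h1, e1⟩ := hpos i hi
    obtain ⟨h2, e2⟩ := hpos (i + 1) (by omega)
    have hi' : (0 : ℝ) ≤ i := by exact_mod_cast hi
    have hle : cutPoint μ x₀ r i ≤ cutPoint μ x₀ r (i + 1) := by
      by_contra hcon
      push Not at hcon
      have := measure_mono (μ := μ) (Ico_subset_Ico (le_refl x₀) hcon.le)
      rw [e1, e2, ENNReal.ofReal_le_ofReal_iff (by positivity)] at this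
      push_cast at this
      nlinarith
    have hu := measure_union (μ := μ) (s₁ := Ico x₀ (cutPoint μ x₀ r i))
      (s₂ := Ico (cutPoint μ x₀ r i) (cutPoint μ x₀ r (i + 1)))
      (Ico_disjoint_Ico_same) measurableSet_Ico
    rw [Ico_union_Ico_eq_Ico h1 hle, e1, e2] at hu
    have : ENNReal.ofReal (((i + 1 : ℤ) : ℝ) * r) =
        ENNReal.ofReal (i * r) + ENNReal.ofReal r := by
      rw [← ENNReal.ofReal_add (by positivity) hr.le]; congr 1; push_cast; ring
    rw [this] at hu
    exact ((ENNReal.add_right_inj ENNReal.ofReal_ne_top).1 hu).symm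
  · obtain ⟨h1, e1⟩ := hneg i hi.le
    obtain ⟨h2, e2⟩ := hneg (i + 1) (by omega)
    have hi' : (i : ℝ) + 1 ≤ 0 := by exact_mod_cast hi
    have hm : 0 ≤ -((i : ℝ) + 1) * r := mul_nonneg (by linarith) hr.le
    have hle : cutPoint μ x₀ r i ≤ cutPoint μ x₀ r (i + 1) := by
      by_contra hcon
      push Not at hcon
      have := measure_mono (μ := μ) (Ico_subset_Ico hcon.le (le_refl x₀))
      rw [e1, e2, ENNReal.ofReal_le_ofReal_iff (by push_cast; exact hm)] at this
      push_cast at this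
      nlinarith
    have hu := measure_union (μ := μ) (s₁ := Ico (cutPoint μ x₀ r i) (cutPoint μ x₀ r (i + 1)))
      (s₂ := Ico (cutPoint μ x₀ r (i + 1)) x₀)
      (Ico_disjoint_Ico_same) measurableSet_Ico
    rw [Ico_union_Ico_eq_Ico hle h2, e1, e2] at hu
    have : ENNReal.ofReal (-(i : ℝ) * r) =
        ENNReal.ofReal r + ENNReal.ofReal (-((i + 1 : ℤ) : ℝ) * r) := by
      rw [← ENNReal.ofReal_add hr.le (by push_cast; exact hm)]; congr 1; push_cast; ring
    rw [this] at hu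
    exact ((ENNReal.add_left_inj ENNReal.ofReal_ne_top).1 hu).symm

/-- The norm `_r‖f‖_{q,p}`: the `ℓ^p` norm over `i ∈ ℤ` of `‖f χ_{I_i^r}‖_{L^q(μ)}`. -/
def stepNorm {E : Type*} [ENorm E] (μ : Measure ℝ) (x₀ r : ℝ) (q p : ℝ≥0∞) (f : ℝ → E) : ℝ≥0∞ :=
  if p = ∞ then ⨆ i : ℤ, eLpNorm f q (μ.restrict (cell μ x₀ r i))
  else (∑' i : ℤ, eLpNorm f q (μ.restrict (cell μ x₀ r i)) ^ p.toReal) ^ (1 / p.toReal)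

/-- The norm `‖f‖_{q,p,α} = sup_{r > 0} r^{1/α - 1/q} _r‖f‖_{q,p}`. -/
def fracNorm {E : Type*} [ENorm E] (μ : Measure ℝ) (x₀ : ℝ) (q p α : ℝ≥0∞) (f : ℝ → E) : ℝ≥0∞ :=
  ⨆ (r : ℝ) (_ : 0 < r),
    ENNReal.ofReal r ^ ((α⁻¹).toReal - (q⁻¹).toReal) * stepNorm μ x₀ r q p f

/-- The weak Lebesgue quasi-norm `‖g‖*_{η,∞} = sup_{t > 0} t μ{|g| > t}^{1/η}`, `0 < η < ∞`. -/
def weakNorm (μ : Measure ℝ) (η : ℝ) (g : ℝ → ℝ≥0∞) : ℝ≥0∞ :=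
  ⨆ (t : ℝ≥0) (_ : 0 < t), (t : ℝ≥0∞) * μ {x | (t : ℝ≥0∞) < g x} ^ (1 / η)

/-- The potential-type operator `Kf(x) = ∫ k(x - y) f(y) dμ(y)` on nonnegative functions. -/
def potential (μ : Measure ℝ) (k : ℝ → ℝ≥0∞) (f : ℝ → ℝ≥0) (x : ℝ) : ℝ≥0∞ :=
  ∫⁻ y, k (x - y) * (f y : ℝ≥0∞) ∂μ

/-- The two-exponent weight condition on `v` with constant `C`, over all intervals `I` for which the
averages make sense (`0 < μ I < ∞`); negative powers of `v` are `+∞` where `v` vanishes. -/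
def WeightCondition (μ : Measure ℝ) (θ : ℝ) (q q₁ : ℝ≥0∞) (v : ℝ → ℝ≥0) (C : ℝ≥0) : Prop :=
  ∀ I : Set ℝ, I.OrdConnected → μ I ≠ 0 → μ I ≠ ∞ →
    (q < q₁ →
      ((μ I)⁻¹ * ∫⁻ x in I, (v x : ℝ≥0∞) ^ θ ∂μ) ^ (1 / θ) *
        ((μ I)⁻¹ * ∫⁻ x in I,
            (v x : ℝ≥0∞) ^ (-(q₁.toReal * q.toReal / (q₁.toReal - q.toReal))) ∂μ) ^
          ((q₁.toReal - q.toReal) / (q₁.toReal * q.toReal)) ≤ C) ∧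
    (q = q₁ →
      ((μ I)⁻¹ * ∫⁻ x in I, (v x : ℝ≥0∞) ^ θ ∂μ) ^ (1 / θ) *
        essSup (fun x => (v x : ℝ≥0∞)⁻¹) (μ.restrict I) ≤ C)

end Amalgam

end

namespace Amalgam

/-! Write `P = q₁`, `κ = 1/η = 1 - 1/β = 1/θ + 1 - 1/P` and `w = v^θ μ`. The hypotheses enter
through two estimates. Monotonicity of `k` and its weak norm give `k (x - y) ≤ M μ[x, y]^(-κ)`
(`kernel_mul_measure_uIcc_le`), so `K` is dominated by a fractional integral whose distance is
measured by `μ`. Hölder's inequality turns the weight condition into `w(I)^(1/θ) ∫_I f dμ ≤ C μ(I)^κ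
‖f v‖_{L^P(I)}` (`AverageBound`).

First inequality. Cut each half line at `x` into shells bounded by intervals of `w`-mass `c a^i`, `i
∈ ℤ`. Testing `AverageBound` on indicators shows that `w` is of `A_∞` type, so for a suitable `a >
1` consecutive intervals have `μ`-measures within a factor 2, and shell `i` contributes a multiple
of `(c a^(i+1))^(-1/θ)` times the `L^P` norm of `f v` on the interval of mass `c a^(i+1)`. Put `n =
∫ (f v)^P`. If `∫_I (f v)^P ≤ (n/c) w(I)` for all intervals `I` touching `x`, the shells of small
mass gain a factor `a^((i+1)/P)`. Since `1/P > 1/θ > 0`, the series converges at both ends, and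
`Kf(x)` is at most a constant times `c^(-1/θ) n^(1/P)` (`lintegral_kernel_side_le`). For `c` such
that this is at most `λ`, each point of `F_λ` touches an interval violating the bound, and a Vitali
covering adapted to `w` gives `w(F_λ) ≤ 3c` (`exists_weak_type`).

Second inequality. At scale `r`, the part of `Kf(x)` coming from outside the cell of `x` and its two
neighbours is at most a constant times `r^(-1/s) ‖f‖_{q,∞,α}` (`lintegral_kernel_far_le`). Choose
`r` so that this is at most `λ/2`, apply the first inequality to `f` restricted to each triple of
cells, and sum using `ℓ^{p₁} ⊆ ℓ^θ` (`weight_rpow_le_of_far_le`). The choice of `r` produces the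
power of `λ⁻¹ ‖f‖_{q,∞,α}`. -/

/-! ### A weak-type covering estimate for intervals -/

/-- A finite family of intervals meeting `Ioo p.1 p.2`, none of them of larger measure, covers a set
of at most three times the measure of that interval. -/
theorem measure_biUnion_meeting_le (w : Measure ℝ) (s : Finset (ℝ × ℝ)) (p : ℝ × ℝ) (hp : p ∈ s)
    (hmeet : ∀ q ∈ s, (Ioo q.1 q.2 ∩ Ioo p.1 p.2).Nonempty)
    (hle : ∀ q ∈ s, w (Ioo q.1 q.2) ≤ w (Ioo p.1 p.2)) :
    w (⋃ q ∈ s, Ioo q.1 q.2) ≤ 3 * w (Ioo p.1 p.2) := by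
  -- Since the intervals reaching furthest left and furthest right both meet `Ioo p.1 p.2`, together
  -- with it they already cover the union.
  obtain ⟨l, hl, hlmin⟩ := s.exists_min_image Prod.fst ⟨p, hp⟩
  obtain ⟨u, hu, humax⟩ := s.exists_max_image Prod.snd ⟨p, hp⟩
  have hsub : (⋃ q ∈ s, Ioo q.1 q.2) ⊆ Ioo p.1 p.2 ∪ Ioo l.1 l.2 ∪ Ioo u.1 u.2 := by
    intro y hy
    simp only [mem_iUnion, exists_prop] at hy
    obtain ⟨q, hq, hyq⟩ := hy
    rcases le_or_gt y p.1 with h1 | h1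
    · obtain ⟨z, hz1, hz2⟩ := hmeet l hl
      exact Or.inl (Or.inr ⟨(hlmin q hq).trans_lt hyq.1, h1.trans_lt (hz2.1.trans hz1.2)⟩)
    rcases le_or_gt p.2 y with h2 | h2
    · obtain ⟨z, hz1, hz2⟩ := hmeet u hu
      exact Or.inr ⟨(hz1.1.trans hz2.2).trans_le h2, hyq.2.trans_le (humax q hq)⟩
    · exact Or.inl (Or.inl ⟨h1, h2⟩)
  calc w (⋃ q ∈ s, Ioo q.1 q.2)
      ≤ w (Ioo p.1 p.2) + w (Ioo l.1 l.2) + w (Ioo u.1 u.2) :=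
        (measure_mono hsub).trans ((measure_union_le _ _).trans
          (add_le_add_left (measure_union_le _ _) _))
    _ ≤ w (Ioo p.1 p.2) + w (Ioo p.1 p.2) + w (Ioo p.1 p.2) :=
        add_le_add (add_le_add le_rfl (hle l hl)) (hle u hu)
    _ = 3 * w (Ioo p.1 p.2) := by ring

/-- Vitali's greedy selection, with size measured by `w` instead of length: remove the interval of
largest `w`-mass together with all those meeting it, and induct. The remaining intervals are
disjoint from the selected one, so the `ν`-masses add. On the line this needs no doubling of `w`. -/
theorem mul_measure_biUnion_le (ν w : Measure ℝ) (τ : ℝ≥0∞) (s : Finset (ℝ × ℝ))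
    (hs : ∀ q ∈ s, τ * w (Ioo q.1 q.2) < ν (Ioo q.1 q.2)) :
    τ * w (⋃ q ∈ s, Ioo q.1 q.2) ≤ 3 * ν (⋃ q ∈ s, Ioo q.1 q.2) := by
  classical
  induction s using Finset.strongInduction with
  | H s ih =>
    rcases s.eq_empty_or_nonempty with rfl | hne
    · simp
    obtain ⟨p, hp, hmax⟩ := s.exists_max_image (fun q => w (Ioo q.1 q.2)) hne
    have hpne : (Ioo p.1 p.2).Nonempty := by
      by_contra h
      have := hs p hp
      rw [not_nonempty_iff_eq_empty.1 h] at this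
      simp at this
    set m := s.filter (fun q => (Ioo q.1 q.2 ∩ Ioo p.1 p.2).Nonempty) with hm
    set d := s.filter (fun q => ¬ (Ioo q.1 q.2 ∩ Ioo p.1 p.2).Nonempty) with hd
    have hpm : p ∈ m := by simp [hm, hp, hpne]
    have hdlt : d ⊂ s := Finset.filter_ssubset.2 ⟨p, hp, by simpa using hpne⟩
    have hds : ∀ q ∈ d, q ∈ s := fun q hq => (Finset.mem_filter.1 hq).1
    have h1 := ih d hdlt fun q hq => hs q (hds q hq)
    have h2 : w (⋃ q ∈ m, Ioo q.1 q.2) ≤ 3 * w (Ioo p.1 p.2) :=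
      measure_biUnion_meeting_le w m p hpm (fun q hq => (Finset.mem_filter.1 hq).2)
        fun q hq => hmax q (Finset.mem_filter.1 hq).1
    have hdisj : Disjoint (⋃ q ∈ d, Ioo q.1 q.2) (Ioo p.1 p.2) := by
      simp only [disjoint_iUnion_left]
      intro q hq
      exact disjoint_iff_inter_eq_empty.2 (not_nonempty_iff_eq_empty.1 (Finset.mem_filter.1 hq).2)
    have hcov : (⋃ q ∈ s, Ioo q.1 q.2) ⊆ (⋃ q ∈ d, Ioo q.1 q.2) ∪ ⋃ q ∈ m, Ioo q.1 q.2 := by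
      intro y hy
      simp only [mem_iUnion, exists_prop, mem_union] at hy ⊢
      obtain ⟨q, hq, hyq⟩ := hy
      by_cases h : (Ioo q.1 q.2 ∩ Ioo p.1 p.2).Nonempty
      · exact Or.inr ⟨q, Finset.mem_filter.2 ⟨hq, h⟩, hyq⟩
      · exact Or.inl ⟨q, Finset.mem_filter.2 ⟨hq, h⟩, hyq⟩
    have hsub : (⋃ q ∈ d, Ioo q.1 q.2) ∪ Ioo p.1 p.2 ⊆ ⋃ q ∈ s, Ioo q.1 q.2 := by
      refine union_subset ?_ ?_
      · exact biUnion_subset_biUnion_left hds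
      · exact subset_biUnion_of_mem (u := fun q : ℝ × ℝ => Ioo q.1 q.2) hp
    calc τ * w (⋃ q ∈ s, Ioo q.1 q.2)
        ≤ τ * (w (⋃ q ∈ d, Ioo q.1 q.2) + 3 * w (Ioo p.1 p.2)) := by
          gcongr
          exact (measure_mono hcov).trans ((measure_union_le _ _).trans (add_le_add le_rfl h2))
      _ = τ * w (⋃ q ∈ d, Ioo q.1 q.2) + 3 * (τ * w (Ioo p.1 p.2)) := by ring
      _ ≤ 3 * ν (⋃ q ∈ d, Ioo q.1 q.2) + 3 * ν (Ioo p.1 p.2) := by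
          gcongr
          exact (hs p hp).le
      _ = 3 * ν ((⋃ q ∈ d, Ioo q.1 q.2) ∪ Ioo p.1 p.2) := by
          rw [measure_union hdisj measurableSet_Ioo, mul_add]
      _ ≤ 3 * ν (⋃ q ∈ s, Ioo q.1 q.2) := by gcongr

/-- Weak type `(1, 1)` of the maximal operator over intervals, relative to a measure `w`. -/
theorem mul_measure_le_of_forall_exists_Ico (ν w : Measure ℝ) [IsLocallyFiniteMeasure w]
    [NullSingletonClass w] (τ : ℝ≥0∞) (hτ0 : τ ≠ 0) (hτ : τ ≠ ∞) (E : Set ℝ)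
    (hE : ∀ x ∈ E, ∃ a b, a ≤ x ∧ x ≤ b ∧ τ * w (Ico a b) < ν (Ico a b)) :
    τ * w E ≤ 3 * ν univ := by
  have hopen : ∀ x ∈ E, ∃ p : ℝ × ℝ, x ∈ Ioo p.1 p.2 ∧ τ * w (Ioo p.1 p.2) < ν (Ioo p.1 p.2) := by
    intro x hx
    obtain ⟨a, b, hax, hxb, hlt⟩ := hE x hx
    -- The point `x` may be an end point, so the interval is enlarged to an open one. Closing it
    -- costs no `w`-mass, outer regularity keeps the strict inequality, and `ν` only increases.
    have hlt' : w (Icc a b) < ν (Ico a b) / τ := by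
      rw [← measure_congr (Ico_ae_eq_Icc (μ := w) (a := a) (b := b))]
      rw [ENNReal.lt_div_iff_mul_lt (Or.inl hτ0) (Or.inl hτ), mul_comm]
      exact hlt
    obtain ⟨U, hU, hUo, hUw⟩ := Set.exists_isOpen_lt_of_lt _ _ hlt'
    have hab := hax.trans hxb
    obtain ⟨a', ha', haU⟩ := exists_Ioc_subset_of_mem_nhds
      (hUo.mem_nhds (hU (left_mem_Icc.2 hab))) ⟨a - 1, by linarith⟩
    obtain ⟨b', hb', hbU⟩ := exists_Ico_subset_of_mem_nhds
      (hUo.mem_nhds (hU (right_mem_Icc.2 hab))) ⟨b + 1, by linarith⟩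
    have hsub : Ioo a' b' ⊆ U := by
      intro y hy
      rcases le_or_gt y a with h1 | h1
      · exact haU ⟨hy.1, h1⟩
      rcases le_or_gt b y with h2 | h2
      · exact hbU ⟨h2, hy.2⟩
      · exact hU ⟨h1.le, h2.le⟩
    refine ⟨(a', b'), ⟨by simpa using ha'.trans_le hax, by simpa using hxb.trans_lt hb'⟩, ?_⟩
    calc τ * w (Ioo a' b') ≤ τ * w U := by gcongr
      _ < ν (Ico a b) := by
        rwa [ENNReal.lt_div_iff_mul_lt (Or.inl hτ0) (Or.inl hτ), mul_comm] at hUw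
      _ ≤ ν (Ioo a' b') := measure_mono fun y hy => ⟨ha'.trans_le hy.1, hy.2.trans hb'⟩
  set T := {p : ℝ × ℝ | τ * w (Ioo p.1 p.2) < ν (Ioo p.1 p.2)} with hT
  set U := ⋃ p : T, Ioo p.1.1 p.1.2 with hU
  have hEU : E ⊆ U := fun x hx => by
    obtain ⟨p, hxp, hp⟩ := hopen x hx
    exact mem_iUnion.2 ⟨⟨p, hp⟩, hxp⟩
  have hUo : IsOpen U := isOpen_iUnion fun _ => isOpen_Ioo
  -- Inner regularity of the open set `U` by compact sets reduces the claim to finite families; `E`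
  -- itself need not be measurable.
  have hU3 : w U ≤ 3 * ν univ / τ := by
    rw [hUo.measure_eq_iSup_isCompact]
    refine iSup_le fun K => iSup_le fun hKU => iSup_le fun hK => ?_
    obtain ⟨s, hs⟩ := hK.elim_finite_subcover (fun p : T => Ioo p.1.1 p.1.2)
      (fun _ => isOpen_Ioo) hKU
    classical
    have h := mul_measure_biUnion_le ν w τ (s.image Subtype.val) (by
      intro q hq
      obtain ⟨p, -, rfl⟩ := Finset.mem_image.1 hq
      exact p.2)
    rw [ENNReal.le_div_iff_mul_le (Or.inl hτ0) (Or.inl hτ), mul_comm]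
    calc τ * w K ≤ τ * w (⋃ q ∈ s.image Subtype.val, Ioo q.1 q.2) := by
          gcongr
          simpa using hs
      _ ≤ _ := h
      _ ≤ 3 * ν univ := by gcongr; exact subset_univ _
  calc τ * w E ≤ τ * (3 * ν univ / τ) := by gcongr; exact (measure_mono hEU).trans hU3
    _ = 3 * ν univ := ENNReal.mul_div_cancel hτ0 hτ

/-! ### Consequences of the hypotheses on the kernel and on the weight -/

/-- A radially non-increasing kernel in weak `L^η`, uniformly in translations, is dominated by a
power of the measure of the interval between the two variables. -/
theorem kernel_mul_measure_uIcc_le (μ : Measure ℝ) [IsLocallyFiniteMeasure μ]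
    [NullSingletonClass μ] (η : ℝ) (hη : 0 < η) (k : ℝ → ℝ≥0∞)
    (hk_even : ∀ x, k (-x) = k x) (hk_anti : AntitoneOn k (Ioi 0)) (x y : ℝ) :
    k (x - y) * μ (uIcc x y) ^ (1 / η) ≤ ⨆ x : ℝ, weakNorm μ η (fun y => k (x - y)) := by
  rcases eq_or_ne y x with rfl | hxy
  · simp [hη]
  have habs : ∀ z, k |z| = k z := fun z => by
    rcases abs_choice z with h | h <;> rw [h]
    exact hk_even z
  have key : ∀ t : ℝ≥0, (t : ℝ≥0∞) < k (x - y) → (t : ℝ≥0∞) * μ (uIcc x y) ^ (1 / η) ≤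
      ⨆ x : ℝ, weakNorm μ η (fun y => k (x - y)) := by
    intro t ht
    rcases eq_or_ne t 0 with rfl | ht0
    · simp
    -- All points between `x` and `y` are at least as close to `x` as `y` is, so the kernel exceeds
    -- `t` there. The point `x` is left out because monotonicity is known only on `(0, ∞)`; it is a
    -- null set.
    have hsub : uIcc x y \ {x} ⊆ {z | (t : ℝ≥0∞) < k (x - z)} := by
      rintro z ⟨hz, hzx⟩
      have h1 : |x - z| ≤ |x - y| := by
        rw [abs_sub_comm x z, abs_sub_comm x y]; exact abs_sub_left_of_mem_uIcc hz
      have h2 : 0 < |x - z| := abs_pos.2 (sub_ne_zero.2 fun h => hzx h.symm)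
      have := hk_anti (mem_Ioi.2 h2) (mem_Ioi.2 (h2.trans_le h1)) h1
      rw [habs, habs] at this
      exact ht.trans_le this
    calc (t : ℝ≥0∞) * μ (uIcc x y) ^ (1 / η)
        = t * μ (uIcc x y \ {x}) ^ (1 / η) := by
          rw [measure_sdiff_null (measure_singleton x)]
      _ ≤ t * μ {z | (t : ℝ≥0∞) < k (x - z)} ^ (1 / η) := by gcongr
      _ ≤ weakNorm μ η (fun y => k (x - y)) :=
          le_iSup₂_of_le (f := fun (t : ℝ≥0) (_ : 0 < t) =>
            (t : ℝ≥0∞) * μ {z | (t : ℝ≥0∞) < k (x - z)} ^ (1 / η)) t (pos_iff_ne_zero.2 ht0) le_rfl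
      _ ≤ _ := le_iSup (fun x : ℝ => weakNorm μ η (fun y => k (x - y))) x
  have hfin : μ (uIcc x y) ^ (1 / η) ≠ ∞ :=
    ENNReal.rpow_ne_top_of_nonneg (by positivity) isCompact_uIcc.measure_lt_top.ne
  rcases eq_or_ne (μ (uIcc x y) ^ (1 / η)) 0 with h0 | h0
  · rw [h0]; simp
  rw [← ENNReal.le_div_iff_mul_le (Or.inl h0) (Or.inl hfin)]
  refine ENNReal.le_of_forall_nnreal_lt fun t ht => ?_
  rw [ENNReal.le_div_iff_mul_le (Or.inl h0) (Or.inl hfin)]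
  exact key t ht

theorem lintegral_le_rpow_mul_measure_rpow {Ω : Type*} [MeasurableSpace Ω] (m : Measure Ω)
    (q : ℝ) (hq : 1 ≤ q) (f : Ω → ℝ≥0∞) (hf : AEMeasurable f m) :
    ∫⁻ x, f x ∂m ≤ (∫⁻ x, f x ^ q ∂m) ^ (1 / q) * m univ ^ (1 - 1 / q) := by
  rcases hq.eq_or_lt with rfl | hq
  · simp
  have h := ENNReal.lintegral_mul_le_Lp_mul_Lq m (Real.HolderConjugate.conjExponent hq) hf
    (aemeasurable_const (b := (1 : ℝ≥0∞)))
  have he : 1 / q.conjExponent = 1 - 1 / q := by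
    have := (Real.HolderConjugate.conjExponent hq).inv_add_inv_eq_one
    simp only [one_div]; linarith
  simpa [he] using h

/-- The form in which a two-exponent weight condition is used: a bound for the average of `f` over
an interval by its weighted `L^P` norm there. -/
def AverageBound (μ : Measure ℝ) (v : ℝ → ℝ≥0) (θ κ P : ℝ) (C : ℝ≥0) : Prop :=
  ∀ (a b : ℝ) (f : ℝ → ℝ≥0∞), AEMeasurable f μ →
    (∫⁻ x in Ico a b, (v x : ℝ≥0∞) ^ θ ∂μ) ^ (1 / θ) * ∫⁻ x in Ico a b, f x ∂μ ≤
      C * μ (Ico a b) ^ κ * (∫⁻ x in Ico a b, (f x * v x) ^ P ∂μ) ^ (1 / P)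

/-- Common part of the cases `q < q₁` and `q = q₁`: `D` stands for the norm of `v⁻¹` on the
interval. Hölder from exponent 1 to `Q` supplies the missing power `1 - 1/Q` of the measure. The
bound through `D` is required only where the weight is not null, since otherwise `D` may be infinite
and carry no information. -/
theorem averageBound_of_exists (μ : Measure ℝ) [IsLocallyFiniteMeasure μ] (v : ℝ → ℝ≥0)
    (θ κ P Q : ℝ) (hθ : 0 < θ) (hQ : 1 ≤ Q) (hκ : κ = 1 / θ + 1 - 1 / P) (C : ℝ≥0)
    (h : ∀ a b, μ (Ico a b) ≠ 0 → ∃ D : ℝ≥0∞,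
      (∫⁻ x in Ico a b, (v x : ℝ≥0∞) ^ θ ∂μ) ^ (1 / θ) * D ≤
        C * μ (Ico a b) ^ (1 / θ + 1 / Q - 1 / P) ∧
      (∫⁻ x in Ico a b, (v x : ℝ≥0∞) ^ θ ∂μ ≠ 0 → ∀ f : ℝ → ℝ≥0∞, AEMeasurable f μ →
        (∫⁻ x in Ico a b, f x ^ Q ∂μ) ^ (1 / Q) ≤
          (∫⁻ x in Ico a b, (f x * v x) ^ P ∂μ) ^ (1 / P) * D)) :
    AverageBound μ v θ κ P C := by
  intro a b f hf
  set I := Ico a b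
  set W := ∫⁻ x in I, (v x : ℝ≥0∞) ^ θ ∂μ with hW
  rcases eq_or_ne W 0 with hW0 | hW0
  · rw [hW0, ENNReal.zero_rpow_of_pos (by positivity), zero_mul]
    exact zero_le
  have hm0 : μ I ≠ 0 := fun h0 => hW0 (setLIntegral_measure_zero _ _ h0)
  have hmt : μ I ≠ ∞ := measure_Ico_lt_top.ne
  obtain ⟨D, hD, hfD⟩ := h a b hm0
  calc W ^ (1 / θ) * ∫⁻ x in I, f x ∂μ
      ≤ W ^ (1 / θ) * ((∫⁻ x in I, f x ^ Q ∂μ) ^ (1 / Q) * μ I ^ (1 - 1 / Q)) := by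
        gcongr
        simpa using lintegral_le_rpow_mul_measure_rpow (μ.restrict I) Q hQ f hf.restrict
    _ ≤ W ^ (1 / θ) * ((∫⁻ x in I, (f x * v x) ^ P ∂μ) ^ (1 / P) * D * μ I ^ (1 - 1 / Q)) := by
        gcongr
        exact hfD hW0 f hf
    _ = (W ^ (1 / θ) * D) * μ I ^ (1 - 1 / Q) * (∫⁻ x in I, (f x * v x) ^ P ∂μ) ^ (1 / P) := by
        ring
    _ ≤ (C * μ I ^ (1 / θ + 1 / Q - 1 / P)) * μ I ^ (1 - 1 / Q) *
          (∫⁻ x in I, (f x * v x) ^ P ∂μ) ^ (1 / P) := by gcongr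
    _ = C * μ I ^ κ * (∫⁻ x in I, (f x * v x) ^ P ∂μ) ^ (1 / P) := by
        rw [mul_assoc (C : ℝ≥0∞), ← ENNReal.rpow_add _ _ hm0 hmt]
        congr 3
        rw [hκ]; ring

/-- Write `f = (f v) v⁻¹` and apply Hölder with `1/q = 1/q₁ + 1/e`, where `e = q₁ q / (q₁ - q)`, or
with the essential supremum of `v⁻¹` if `q = q₁`. The weight condition bounds exactly the resulting
norm of `v⁻¹` times `w(I)^(1/θ)`. -/
theorem WeightCondition.averageBound {μ : Measure ℝ} [IsLocallyFiniteMeasure μ] {θ κ : ℝ}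
    {q q₁ : ℝ≥0∞} {v : ℝ → ℝ≥0} {C : ℝ≥0} (h : WeightCondition μ θ q q₁ v C)
    (hv : AEMeasurable v μ) (hθ : 0 < θ) (hq : 1 ≤ q) (hqq₁ : q ≤ q₁) (hq₁ : q₁ ≠ ∞)
    (hκ : κ = 1 / θ + 1 - 1 / q₁.toReal) : AverageBound μ v θ κ q₁.toReal C := by
  have hqt : q ≠ ∞ := ne_top_of_le_ne_top hq₁ hqq₁
  have hQ : 1 ≤ q.toReal := by simpa using ENNReal.toReal_mono hqt hq
  have hQP : q.toReal ≤ q₁.toReal := ENNReal.toReal_mono hq₁ hqq₁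
  refine averageBound_of_exists μ v θ κ q₁.toReal q.toReal hθ hQ hκ C fun a b hm0 => ?_
  set Q := q.toReal
  set P := q₁.toReal
  set I := Ico a b
  have hmt : μ I ≠ ∞ := measure_Ico_lt_top.ne
  set W := ∫⁻ x in I, (v x : ℝ≥0∞) ^ θ ∂μ with hW
  have hvI : AEMeasurable (fun x => (v x : ℝ≥0∞)) (μ.restrict I) := hv.coe_nnreal_ennreal.restrict
  obtain ⟨hlt, heq⟩ := h I ordConnected_Ico hm0 hmt
  have hW' : ((μ I)⁻¹ * W) ^ (1 / θ) = μ I ^ (-(1 / θ)) * W ^ (1 / θ) := by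
    rw [ENNReal.mul_rpow_of_nonneg _ _ (by positivity), ENNReal.inv_rpow, ENNReal.rpow_neg]
  have hpos : W ≠ 0 → μ I ^ (-(1 / θ)) * W ^ (1 / θ) ≠ 0 := fun hW0 => by
    rw [mul_ne_zero_iff]
    refine ⟨?_, ?_⟩
    · rw [ENNReal.rpow_neg]
      exact ENNReal.inv_ne_zero.2 (ENNReal.rpow_ne_top_of_nonneg (by positivity) hmt)
    · rw [Ne, ENNReal.rpow_eq_zero_iff_of_pos (by positivity)]; exact hW0
  have hcancel : ∀ e : ℝ, μ I ^ e * μ I ^ (-e) = 1 := fun e => by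
    rw [← ENNReal.rpow_add _ _ hm0 hmt]; simp
  rcases hqq₁.lt_or_eq with hqlt | hqeq
  · have hQPlt : Q < P := (ENNReal.toReal_lt_toReal hqt hq₁).2 hqlt
    set e := P * Q / (P - Q) with he
    have hepos : 0 < e := div_pos (by nlinarith) (by linarith)
    have hP0 : 0 < P := by linarith
    have hQ0 : 0 < Q := by linarith
    have heinv : (P - Q) / (P * Q) = 1 / e := by rw [he, one_div_div]
    have heQ : 1 / Q = 1 / P + 1 / e := by
      rw [← heinv]; field_simp; ring
    have h1 := hlt hqlt
    rw [heinv, hW', ENNReal.mul_rpow_of_nonneg _ _ (by positivity), ENNReal.inv_rpow,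
      ← ENNReal.rpow_neg] at h1
    set D := ∫⁻ x in I, (v x : ℝ≥0∞) ^ (-e) ∂μ with hD
    refine ⟨D ^ (1 / e), ?_, fun hW0 f hf => ?_⟩
    · calc W ^ (1 / θ) * D ^ (1 / e)
          = (μ I ^ (1 / θ) * μ I ^ (-(1 / θ))) * (μ I ^ (1 / e) * μ I ^ (-(1 / e))) *
              (W ^ (1 / θ) * D ^ (1 / e)) := by rw [hcancel, hcancel]; ring
        _ = (μ I ^ (-(1 / θ)) * W ^ (1 / θ) * (μ I ^ (-(1 / e)) * D ^ (1 / e))) *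
              (μ I ^ (1 / θ) * μ I ^ (1 / e)) := by ring
        _ ≤ C * (μ I ^ (1 / θ) * μ I ^ (1 / e)) := by gcongr
        _ = C * μ I ^ (1 / θ + 1 / Q - 1 / P) := by
            rw [← ENNReal.rpow_add _ _ hm0 hmt, heQ]; congr 2; ring
    -- The other factor in the weight condition is nonzero, so `D` is finite. Hence `v` is nonzero
    -- almost everywhere on the interval, which legitimates `f = (f v) v⁻¹`.
    · have hDfin : D ≠ ∞ := by
        intro hDt
        rw [hDt, ENNReal.top_rpow_of_pos (by positivity), ENNReal.mul_top, ENNReal.mul_top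
          (hpos hW0)] at h1
        · exact ENNReal.coe_ne_top (top_le_iff.1 h1)
        · rw [ENNReal.rpow_neg]
          exact ENNReal.inv_ne_zero.2 (ENNReal.rpow_ne_top_of_nonneg (by positivity) hmt)
      have hv0 : ∀ᵐ x ∂μ.restrict I, v x ≠ 0 := by
        filter_upwards [ae_lt_top' (hvI.pow_const (-e)) hDfin] with x hx h0
        rw [h0, ENNReal.coe_zero, ENNReal.zero_rpow_of_neg (by linarith)] at hx
        exact lt_irrefl _ hx
      have hH := ENNReal.lintegral_Lp_mul_le_Lq_mul_Lr hQ0 hQPlt heQ (μ.restrict I)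
        (hf.restrict.mul hvI) hvI.inv
      refine le_trans (le_of_eq ?_) (hH.trans (le_of_eq ?_))
      · congr 1
        refine lintegral_congr_ae ?_
        filter_upwards [hv0] with x hx
        simp only [Pi.mul_apply, Pi.inv_apply]
        rw [mul_assoc, ENNReal.mul_inv_cancel (by exact_mod_cast hx) ENNReal.coe_ne_top, mul_one]
      · simp only [Pi.mul_apply, Pi.inv_apply, ENNReal.inv_rpow, hD, ENNReal.rpow_neg]
  · have hQPeq : Q = P := by simp only [Q, P, hqeq]
    have h1 := heq hqeq
    rw [hW'] at h1
    set S := essSup (fun x => (v x : ℝ≥0∞)⁻¹) (μ.restrict I) with hS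
    refine ⟨S, ?_, fun hW0 f hf => ?_⟩
    · calc W ^ (1 / θ) * S
          = (μ I ^ (1 / θ) * μ I ^ (-(1 / θ))) * (W ^ (1 / θ) * S) := by rw [hcancel]; ring
        _ = (μ I ^ (-(1 / θ)) * W ^ (1 / θ) * S) * μ I ^ (1 / θ) := by ring
        _ ≤ C * μ I ^ (1 / θ) := by gcongr
        _ = C * μ I ^ (1 / θ + 1 / Q - 1 / P) := by rw [hQPeq]; congr 2; ring
    · have hSfin : S ≠ ∞ := by
        intro hSt
        rw [hSt, ENNReal.mul_top (hpos hW0)] at h1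
        exact ENNReal.coe_ne_top (top_le_iff.1 h1)
      have hle : ∀ᵐ x ∂μ.restrict I, f x ≤ S * (f x * v x) := by
        filter_upwards [ENNReal.ae_le_essSup (μ := μ.restrict I) (fun x => (v x : ℝ≥0∞)⁻¹)] with x hx
        have hx0 : (v x : ℝ≥0∞) ≠ 0 := by
          intro h0
          rw [h0, ENNReal.inv_zero] at hx
          exact hSfin (top_le_iff.1 hx)
        calc f x = (v x : ℝ≥0∞)⁻¹ * (f x * v x) := by
              rw [mul_comm (f x), ← mul_assoc, ENNReal.inv_mul_cancel hx0 ENNReal.coe_ne_top,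
                one_mul]
          _ ≤ S * (f x * v x) := by gcongr
      have hQ0 : 0 < Q := by linarith
      rw [← hQPeq]
      calc (∫⁻ x in I, f x ^ Q ∂μ) ^ (1 / Q)
          ≤ (∫⁻ x in I, S ^ Q * (f x * v x) ^ Q ∂μ) ^ (1 / Q) := by
            gcongr ?_ ^ _
            refine lintegral_mono_ae ?_
            filter_upwards [hle] with x hx
            rw [← ENNReal.mul_rpow_of_nonneg _ _ hQ0.le]
            gcongr
        _ = (∫⁻ x in I, (f x * v x) ^ Q ∂μ) ^ (1 / Q) * S := by
            rw [lintegral_const_mul'' (f := fun x => (f x * v x) ^ Q) _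
              ((hf.restrict.mul hvI).pow_const Q),
              ENNReal.mul_rpow_of_nonneg _ _ (by positivity), ← ENNReal.rpow_mul,
              mul_one_div_cancel hQ0.ne', ENNReal.rpow_one, mul_comm]

/-! ### Comparison of the weight with `μ`: local finiteness and the `A_∞` property -/

namespace AverageBound

variable {μ : Measure ℝ} {v : ℝ → ℝ≥0} {θ κ P : ℝ} {C : ℝ≥0}

/-- Test the bound on `f = min 1 v⁻¹`: it is positive because `v` is finite, while `f v ≤ 1` keeps
the right-hand side finite. An infinite weight would make the left-hand side infinite. -/
theorem weight_Ico_lt_top [IsLocallyFiniteMeasure μ] (h : AverageBound μ v θ κ P C)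
    (hv : AEMeasurable v μ) (hθ : 0 < θ) (hκ : 0 < κ) (hP : 0 < P) (a b : ℝ) :
    ∫⁻ x in Ico a b, (v x : ℝ≥0∞) ^ θ ∂μ < ∞ := by
  by_contra hcon
  rw [not_lt, top_le_iff] at hcon
  have hm0 : μ (Ico a b) ≠ 0 := fun h0 => by
    rw [setLIntegral_measure_zero _ _ h0] at hcon; exact ENNReal.zero_ne_top hcon
  have hmt : μ (Ico a b) ≠ ∞ := measure_Ico_lt_top.ne
  set f : ℝ → ℝ≥0∞ := fun x => min 1 (v x : ℝ≥0∞)⁻¹ with hf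
  have hfm : AEMeasurable f μ := aemeasurable_const.min hv.coe_nnreal_ennreal.inv
  have h1 := h a b f hfm
  have hfpos : ∫⁻ x in Ico a b, f x ∂μ ≠ 0 := by
    rw [Ne, lintegral_eq_zero_iff' hfm.restrict]
    intro h0
    have : ∀ᵐ x ∂μ.restrict (Ico a b), False := by
      filter_upwards [h0] with x hx
      simp only [hf, Pi.zero_apply, min_eq_bot, ← bot_eq_zero] at hx
      simp at hx
    rw [ae_restrict_iff' measurableSet_Ico] at this
    exact hm0 (measure_mono_null (fun x hx => by simpa using hx) this)
  have hfv : ∀ x, (f x * v x) ^ P ≤ 1 := fun x => by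
    refine ENNReal.rpow_le_one ?_ hP.le
    calc f x * v x ≤ (v x : ℝ≥0∞)⁻¹ * v x := by gcongr; exact min_le_right _ _
      _ ≤ 1 := ENNReal.inv_mul_le_one _
  have h2 : (∫⁻ x in Ico a b, (f x * v x) ^ P ∂μ) ^ (1 / P) ≠ ∞ := by
    refine ENNReal.rpow_ne_top_of_nonneg (by positivity) (ne_top_of_le_ne_top hmt ?_)
    calc ∫⁻ x in Ico a b, (f x * v x) ^ P ∂μ ≤ ∫⁻ x in Ico a b, 1 ∂μ := lintegral_mono hfv
      _ = μ (Ico a b) := by simp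
  rw [hcon, ENNReal.top_rpow_of_pos (by positivity), ENNReal.top_mul hfpos, top_le_iff] at h1
  exact ENNReal.mul_ne_top (ENNReal.mul_ne_top ENNReal.coe_ne_top
    (ENNReal.rpow_ne_top_of_nonneg hκ.le hmt)) h2 h1

/-- Comparison of the weight of a subset of an interval with that of the interval. -/
theorem weight_mul_measure_le [IsLocallyFiniteMeasure μ] (h : AverageBound μ v θ κ P C)
    (hv : AEMeasurable v μ) (hκ : 0 < κ) (hP : 0 < P) (hPθ : P < θ)
    (hκP : κ = 1 / θ + 1 - 1 / P) (a b : ℝ) (S : Set ℝ) (hS : MeasurableSet S)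
    (hSI : S ⊆ Ico a b) :
    (∫⁻ x in Ico a b, (v x : ℝ≥0∞) ^ θ ∂μ) ^ (1 / θ) * μ S ^ κ ≤
      C * μ (Ico a b) ^ κ * (∫⁻ x in S, (v x : ℝ≥0∞) ^ θ ∂μ) ^ (1 / θ) := by
  have hθ : 0 < θ := hP.trans hPθ
  rcases eq_or_ne (μ S) 0 with h0 | h0
  · rw [h0, ENNReal.zero_rpow_of_pos hκ, mul_zero]; exact zero_le
  have hSt : μ S ≠ ∞ := ((measure_mono hSI).trans_lt measure_Ico_lt_top).ne
  -- With `f` the indicator of `S`, the right-hand side contains the `L^P` norm of `v` on `S`.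
  -- Hölder passes from `P` to `θ` at the cost of `μ(S)^(1/P - 1/θ)`, and dividing by this factor
  -- turns `μ(S)` into `μ(S)^κ`.
  have h1 := h a b (S.indicator 1) (aemeasurable_one.indicator hS)
  have e1 : ∫⁻ x in Ico a b, S.indicator 1 x ∂μ = μ S := by
    rw [lintegral_indicator_one hS, Measure.restrict_apply hS, inter_eq_self_of_subset_left hSI]
  have e2 : ∫⁻ x in Ico a b, (S.indicator (1 : ℝ → ℝ≥0∞) x * v x) ^ P ∂μ =
      ∫⁻ x in S, (v x : ℝ≥0∞) ^ P ∂μ := by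
    have : (fun x => (S.indicator (1 : ℝ → ℝ≥0∞) x * v x) ^ P) =
        S.indicator (fun x => (v x : ℝ≥0∞) ^ P) := by
      ext x
      by_cases hx : x ∈ S <;> simp [hx, hP]
    rw [this, lintegral_indicator hS, Measure.restrict_restrict hS,
      inter_eq_self_of_subset_left hSI]
  have e3 : (∫⁻ x in S, (v x : ℝ≥0∞) ^ P ∂μ) ^ (1 / P) ≤
      (∫⁻ x in S, (v x : ℝ≥0∞) ^ θ ∂μ) ^ (1 / θ) * μ S ^ (1 / P - 1 / θ) := by
    have hH := ENNReal.lintegral_Lp_mul_le_Lq_mul_Lr (p := P) (q := θ) (r := 1 / (1 / P - 1 / θ)) hP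
      hPθ (by rw [one_div_one_div]; ring) (μ.restrict S) (f := fun x => (v x : ℝ≥0∞))
      (hv.coe_nnreal_ennreal.restrict) (aemeasurable_const (b := (1 : ℝ≥0∞)))
    simpa using hH
  rw [e1, e2] at h1
  have hκ' : μ S = μ S ^ κ * μ S ^ (1 / P - 1 / θ) := by
    rw [← ENNReal.rpow_add _ _ h0 hSt, hκP]
    ring_nf
    simp
  have hne0 : μ S ^ (1 / P - 1 / θ) ≠ 0 := by
    simp [ENNReal.rpow_eq_zero_iff, h0, hSt]
  have hnet : μ S ^ (1 / P - 1 / θ) ≠ ∞ := by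
    simp [ENNReal.rpow_eq_top_iff, h0, hSt]
  rw [← ENNReal.mul_le_mul_iff_left hne0 hnet]
  calc (∫⁻ x in Ico a b, (v x : ℝ≥0∞) ^ θ ∂μ) ^ (1 / θ) * μ S ^ κ * μ S ^ (1 / P - 1 / θ)
      = (∫⁻ x in Ico a b, (v x : ℝ≥0∞) ^ θ ∂μ) ^ (1 / θ) * μ S := by rw [mul_assoc, ← hκ']
    _ ≤ _ := h1
    _ ≤ C * μ (Ico a b) ^ κ * ((∫⁻ x in S, (v x : ℝ≥0∞) ^ θ ∂μ) ^ (1 / θ) *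
          μ S ^ (1 / P - 1 / θ)) := by gcongr
    _ = _ := by ring

/-- A set carrying most of the weight of an interval carries half of its measure. -/
theorem exists_measure_le_two_mul [IsLocallyFiniteMeasure μ] (h : AverageBound μ v θ κ P C)
    (hv : AEMeasurable v μ) (hκ : 0 < κ) (hP : 0 < P) (hPθ : P < θ)
    (hκP : κ = 1 / θ + 1 - 1 / P) :
    ∃ a : ℝ, 1 < a ∧ ∀ (l r : ℝ) (T : Set ℝ), MeasurableSet T → T ⊆ Ico l r →
      ∫⁻ x in Ico l r, (v x : ℝ≥0∞) ^ θ ∂μ ≠ 0 →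
      ∫⁻ x in Ico l r, (v x : ℝ≥0∞) ^ θ ∂μ ≤ ENNReal.ofReal a * ∫⁻ x in T, (v x : ℝ≥0∞) ^ θ ∂μ →
      μ (Ico l r) ≤ 2 * μ T := by
  have hθ : 0 < θ := hP.trans hPθ
  -- If the complement of `T` carries at most the share `ε = c^θ` of the weight, the preceding
  -- comparison bounds its measure to the power `κ` by `C c μ(I)^κ ≤ (μ(I)/2)^κ`. Using `C + 1`
  -- makes the denominator positive and `c < 1`. The admissible ratio is then `a = (1 - ε)⁻¹`.
  set c : ℝ := (1 / 2) ^ κ / (C + 1) with hc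
  have hc0 : 0 < c := by positivity
  have hc1 : c < 1 := by
    rw [hc, div_lt_one (by positivity)]
    calc (1 / 2 : ℝ) ^ κ < 1 := Real.rpow_lt_one (by norm_num) (by norm_num) hκ
      _ ≤ C + 1 := by linarith [C.2]
  set ε : ℝ := c ^ θ with hε
  have hε0 : 0 < ε := by positivity
  have hε1 : ε < 1 := Real.rpow_lt_one hc0.le hc1 hθ
  have hεc : ENNReal.ofReal ε ^ (1 / θ) = ENNReal.ofReal c := by
    rw [ENNReal.ofReal_rpow_of_pos hε0, hε, ← Real.rpow_mul hc0.le, mul_one_div_cancel hθ.ne',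
      Real.rpow_one]
  refine ⟨(1 - ε)⁻¹, (one_lt_inv₀ (by linarith)).2 (by linarith), fun l r T hT hTI hW0 hWT => ?_⟩
  set I := Ico l r with hI
  set W := ∫⁻ x in I, (v x : ℝ≥0∞) ^ θ ∂μ with hW
  have hWt : W ≠ ∞ := (h.weight_Ico_lt_top hv hθ hκ hP l r).ne
  have hsplit : W = (∫⁻ x in T, (v x : ℝ≥0∞) ^ θ ∂μ) + ∫⁻ x in I \ T, (v x : ℝ≥0∞) ^ θ ∂μ := by
    have := lintegral_inter_add_sdiff (μ := μ) (fun x => (v x : ℝ≥0∞) ^ θ) I hT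
    rw [inter_eq_self_of_subset_right hTI] at this
    exact this.symm
  have hT' : ENNReal.ofReal (1 - ε) * W ≤ ∫⁻ x in T, (v x : ℝ≥0∞) ^ θ ∂μ := by
    rw [ENNReal.ofReal_inv_of_pos (by linarith)] at hWT
    calc ENNReal.ofReal (1 - ε) * W ≤ ENNReal.ofReal (1 - ε) * ((ENNReal.ofReal (1 - ε))⁻¹ *
          ∫⁻ x in T, (v x : ℝ≥0∞) ^ θ ∂μ) := by gcongr
      _ = _ := by
        rw [← mul_assoc, ENNReal.mul_inv_cancel (by simpa using hε1) ENNReal.ofReal_ne_top, one_mul]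
  have hS' : ∫⁻ x in I \ T, (v x : ℝ≥0∞) ^ θ ∂μ ≤ ENNReal.ofReal ε * W := by
    have hfin : ENNReal.ofReal (1 - ε) * W ≠ ∞ := ENNReal.mul_ne_top ENNReal.ofReal_ne_top hWt
    rw [← ENNReal.add_le_add_iff_left hfin]
    calc ENNReal.ofReal (1 - ε) * W + ∫⁻ x in I \ T, (v x : ℝ≥0∞) ^ θ ∂μ
        ≤ (∫⁻ x in T, (v x : ℝ≥0∞) ^ θ ∂μ) + ∫⁻ x in I \ T, (v x : ℝ≥0∞) ^ θ ∂μ := by gcongr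
      _ = W := hsplit.symm
      _ = ENNReal.ofReal (1 - ε) * W + ENNReal.ofReal ε * W := by
        rw [← add_mul, ← ENNReal.ofReal_add (by linarith) hε0.le]; simp
  have h1 := h.weight_mul_measure_le hv hκ hP hPθ hκP l r (I \ T) (measurableSet_Ico.diff hT)
    sdiff_subset
  have hWθ0 : W ^ (1 / θ) ≠ 0 := by
    rw [Ne, ENNReal.rpow_eq_zero_iff_of_pos (by positivity)]; exact hW0
  have hWθt : W ^ (1 / θ) ≠ ∞ := ENNReal.rpow_ne_top_of_nonneg (by positivity) hWt
  have h2 : μ (I \ T) ^ κ ≤ (ENNReal.ofReal (1 / 2) * μ I) ^ κ := by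
    rw [← ENNReal.mul_le_mul_iff_right hWθ0 hWθt]
    calc W ^ (1 / θ) * μ (I \ T) ^ κ
        ≤ C * μ I ^ κ * (ENNReal.ofReal ε * W) ^ (1 / θ) := h1.trans (by gcongr)
      _ = W ^ (1 / θ) * ((C * ENNReal.ofReal c) * μ I ^ κ) := by
          rw [ENNReal.mul_rpow_of_nonneg _ _ (by positivity), hεc]; ring
      _ ≤ W ^ (1 / θ) * (ENNReal.ofReal ((1 / 2) ^ κ) * μ I ^ κ) := by
          gcongr
          rw [← ENNReal.ofReal_coe_nnreal, ← ENNReal.ofReal_mul C.coe_nonneg]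
          refine ENNReal.ofReal_le_ofReal ?_
          rw [hc, mul_div_assoc', div_le_iff₀ (by positivity)]
          nlinarith [show (0 : ℝ) < (1 / 2) ^ κ by positivity]
      _ = W ^ (1 / θ) * (ENNReal.ofReal (1 / 2) * μ I) ^ κ := by
          rw [ENNReal.mul_rpow_of_nonneg _ _ hκ.le, ENNReal.ofReal_rpow_of_pos (by norm_num)]
  rw [ENNReal.rpow_le_rpow_iff hκ] at h2
  have hmt : μ I ≠ ∞ := measure_Ico_lt_top.ne
  have h3 : μ I ≤ μ T + ENNReal.ofReal (1 / 2) * μ I := by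
    calc μ I = μ (I ∩ T) + μ (I \ T) := (measure_inter_add_sdiff I hT).symm
      _ ≤ _ := by rw [inter_eq_self_of_subset_right hTI]; gcongr
  have h4 : ENNReal.ofReal (1 / 2) * μ I ≤ μ T := by
    have hfin : ENNReal.ofReal (1 / 2) * μ I ≠ ∞ := ENNReal.mul_ne_top ENNReal.ofReal_ne_top hmt
    rw [← ENNReal.add_le_add_iff_right hfin, ← add_mul, ← ENNReal.ofReal_add (by norm_num)
      (by norm_num)]
    norm_num
    exact h3.trans_eq (by norm_num)
  calc μ I = 2 * (ENNReal.ofReal (1 / 2) * μ I) := by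
        rw [← mul_assoc, ← ENNReal.ofReal_ofNat 2, ← ENNReal.ofReal_mul (by norm_num)]; norm_num
    _ ≤ 2 * μ T := by gcongr

end AverageBound

/-! ### The weight as a measure -/

/-- The measure with density `v ^ θ`. -/
noncomputable def weight (μ : Measure ℝ) (v : ℝ → ℝ≥0) (θ : ℝ) : Measure ℝ :=
  μ.withDensity fun x => (v x : ℝ≥0∞) ^ θ

theorem weight_apply (μ : Measure ℝ) [SFinite μ] (v : ℝ → ℝ≥0) (θ : ℝ) (s : Set ℝ) :
    weight μ v θ s = ∫⁻ x in s, (v x : ℝ≥0∞) ^ θ ∂μ :=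
  withDensity_apply' _ _

theorem weight_absolutelyContinuous (μ : Measure ℝ) (v : ℝ → ℝ≥0) (θ : ℝ) : weight μ v θ ≪ μ :=
  withDensity_absolutelyContinuous _ _

instance (μ : Measure ℝ) [NullSingletonClass μ] (v : ℝ → ℝ≥0) (θ : ℝ) :
    NullSingletonClass (weight μ v θ) :=
  ⟨fun x => weight_absolutelyContinuous μ v θ (measure_singleton x)⟩

theorem iUnion_Ico_neg_natCast : (⋃ n : ℕ, Ico (-(n : ℝ)) n) = univ := by
  refine eq_univ_of_forall fun y => ?_
  obtain ⟨n, hn⟩ := exists_nat_gt |y|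
  exact mem_iUnion.2 ⟨n, by linarith [neg_abs_le y], by linarith [le_abs_self y]⟩

namespace AverageBound

variable {μ : Measure ℝ} {v : ℝ → ℝ≥0} {θ κ P : ℝ} {C : ℝ≥0}

theorem isLocallyFiniteMeasure_weight [IsLocallyFiniteMeasure μ]
    (h : AverageBound μ v θ κ P C)
    (hv : AEMeasurable v μ) (hθ : 0 < θ) (hκ : 0 < κ) (hP : 0 < P) :
    IsLocallyFiniteMeasure (weight μ v θ) :=
  ⟨fun x => ⟨Ico (x - 1) (x + 1), Ico_mem_nhds (by linarith) (by linarith), by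
    rw [weight_apply]; exact h.weight_Ico_lt_top hv hθ hκ hP _ _⟩⟩

/-- A nontrivial weight is positive almost everywhere. -/
theorem absolutelyContinuous_weight [IsLocallyFiniteMeasure μ] (h : AverageBound μ v θ κ P C)
    (hv : AEMeasurable v μ) (hκ : 0 < κ) (hP : 0 < P) (hPθ : P < θ)
    (hκP : κ = 1 / θ + 1 - 1 / P) (hw : weight μ v θ univ ≠ 0) : μ ≪ weight μ v θ := by
  have hθ : 0 < θ := hP.trans hPθ
  refine Measure.AbsolutelyContinuous.mk fun S hS hS0 => ?_
  have hmono : Monotone fun n : ℕ => Ico (-(n : ℝ)) n := fun m n hmn => by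
    have : (m : ℝ) ≤ n := by exact_mod_cast hmn
    exact Ico_subset_Ico (by linarith) this
  have hlim := tendsto_measure_iUnion_atTop (μ := weight μ v θ) hmono
  rw [iUnion_Ico_neg_natCast] at hlim
  obtain ⟨N, hN⟩ := eventually_atTop.1 (hlim.eventually (lt_mem_nhds (pos_iff_ne_zero.2 hw)))
  -- Once the interval has positive weight, comparing it with a weight-null subset forces that
  -- subset to be `μ`-null.
  have hzero : ∀ n ≥ N, μ (S ∩ Ico (-(n : ℝ)) n) = 0 := fun n hn => by
    have h1 := h.weight_mul_measure_le hv hκ hP hPθ hκP (-(n : ℝ)) n (S ∩ Ico (-(n : ℝ)) n)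
      (hS.inter measurableSet_Ico) inter_subset_right
    rw [← weight_apply, ← weight_apply, measure_mono_null inter_subset_left hS0,
      ENNReal.zero_rpow_of_pos (by positivity), mul_zero, nonpos_iff_eq_zero, mul_eq_zero,
      ENNReal.rpow_eq_zero_iff_of_pos (by positivity), ENNReal.rpow_eq_zero_iff_of_pos hκ] at h1
    exact h1.resolve_left (hN n hn).ne'
  have hcov : S ⊆ ⋃ n : ℕ, S ∩ Ico (-((n + N : ℕ) : ℝ)) ((n + N : ℕ) : ℝ) := by
    intro y hy
    obtain ⟨n, hn⟩ := mem_iUnion.1 (iUnion_Ico_neg_natCast.symm ▸ mem_univ y)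
    exact mem_iUnion.2 ⟨n, hy, hmono (Nat.le_add_right n N) hn⟩
  exact measure_mono_null hcov (measure_iUnion_null fun n => hzero _ (Nat.le_add_left _ _))

/-- A nontrivial weight is infinite on every set of infinite measure exhausted by intervals. -/
theorem weight_iUnion_eq_top [IsLocallyFiniteMeasure μ] (h : AverageBound μ v θ κ P C)
    (hv : AEMeasurable v μ) (hκ : 0 < κ) (hP : 0 < P) (hPθ : P < θ)
    (hκP : κ = 1 / θ + 1 - 1 / P) (hw : weight μ v θ univ ≠ 0) (l r : ℕ → ℝ)
    (hmono : Monotone fun n => Ico (l n) (r n)) (htop : μ (⋃ n, Ico (l n) (r n)) = ∞) :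
    weight μ v θ (⋃ n, Ico (l n) (r n)) = ∞ := by
  obtain ⟨a, ha, hB⟩ := h.exists_measure_le_two_mul hv hκ hP hPθ hκP
  simp only [← weight_apply] at hB
  set w := weight μ v θ
  set D := ⋃ n, Ico (l n) (r n)
  by_contra hfin
  have hD0 : w D ≠ 0 := fun h0 => by
    have := h.absolutelyContinuous_weight hv hκ hP hPθ hκP hw h0
    rw [htop] at this
    exact ENNReal.top_ne_zero this
  have hlim := tendsto_measure_iUnion_atTop (μ := w) hmono
  -- If `D` had finite weight, one interval would carry the share `1/a` of it, hence of every larger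
  -- interval in the sequence. All of these would then have at most twice its `μ`-measure,
  -- contradicting `μ(D) = ∞`.
  have hlt : w D / ENNReal.ofReal a < w D :=
    ENNReal.div_lt_of_lt_mul (by
      conv_lhs => rw [← mul_one (w D)]
      exact ENNReal.mul_lt_mul_right hD0 hfin (by simpa using ha))
  obtain ⟨n, hn⟩ := (hlim.eventually (lt_mem_nhds hlt)).exists
  have hn' : w D ≤ ENNReal.ofReal a * w (Ico (l n) (r n)) := by
    rw [ENNReal.div_lt_iff (Or.inl (by simp; linarith)) (Or.inl ENNReal.ofReal_ne_top)] at hn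
    rw [mul_comm]
    exact hn.le
  have hbound : ∀ m ≥ n, μ (Ico (l m) (r m)) ≤ 2 * μ (Ico (l n) (r n)) := fun m hm => by
    refine hB _ _ _ measurableSet_Ico (hmono hm) ?_ ?_
    · intro h0
      have : w (Ico (l n) (r n)) = 0 := measure_mono_null (hmono hm) h0
      rw [this, mul_zero, nonpos_iff_eq_zero] at hn'
      exact hD0 hn'
    · exact (measure_mono (subset_iUnion (fun n => Ico (l n) (r n)) m)).trans hn'
  have := le_of_tendsto (tendsto_measure_iUnion_atTop (μ := μ) hmono)
    (eventually_atTop.2 ⟨n, hbound⟩)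
  rw [htop, top_le_iff] at this
  exact ENNReal.mul_ne_top (by simp) measure_Ico_lt_top.ne this

/-- This guarantees intervals of every prescribed weight on both sides of every point, which the
shell decomposition uses. -/
theorem weight_eq_top [IsLocallyFiniteMeasure μ] (h : AverageBound μ v θ κ P C)
    (hv : AEMeasurable v μ) (hκ : 0 < κ) (hP : 0 < P) (hPθ : P < θ)
    (hκP : κ = 1 / θ + 1 - 1 / P) (hw : weight μ v θ univ ≠ 0)
    (hμ : ∀ a : ℝ, μ (Iio a) = ∞ ∧ μ (Ici a) = ∞) (a : ℝ) :
    weight μ v θ (Iio a) = ∞ ∧ weight μ v θ (Ici a) = ∞ := by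
  have hU : (⋃ n : ℕ, Ico a (a + n)) = Ici a := by
    ext y
    simp only [mem_iUnion, mem_Ico, mem_Ici]
    refine ⟨fun ⟨n, hn⟩ => hn.1, fun hy => ?_⟩
    obtain ⟨n, hn⟩ := exists_nat_gt (y - a)
    exact ⟨n, hy, by linarith⟩
  have hL : (⋃ n : ℕ, Ico (a - n) a) = Iio a := by
    ext y
    simp only [mem_iUnion, mem_Ico, mem_Iio]
    refine ⟨fun ⟨n, hn⟩ => hn.2, fun hy => ?_⟩
    obtain ⟨n, hn⟩ := exists_nat_gt (a - y)
    exact ⟨n, by linarith, hy⟩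
  constructor
  · rw [← hL]
    refine h.weight_iUnion_eq_top hv hκ hP hPθ hκP hw (fun n => a - n) (fun _ => a)
      (fun m n hmn => Ico_subset_Ico_left ?_) (by rw [hL]; exact (hμ a).1)
    have : (m : ℝ) ≤ n := by exact_mod_cast hmn
    linarith
  · rw [← hU]
    refine h.weight_iUnion_eq_top hv hκ hP hPθ hκP hw (fun _ => a) (fun n => a + n)
      (fun m n hmn => Ico_subset_Ico_right ?_) (by rw [hU]; exact (hμ a).2)
    have : (m : ℝ) ≤ n := by exact_mod_cast hmn
    linarith

end AverageBound

/-! ### Intervals of prescribed measure on one side of a point -/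

/-- A family of intervals with end point `x`, indexed by their `w`-measure, exhausting the half
line `D`. -/
structure OneSidedFamily (w : Measure ℝ) (x : ℝ) (D : Set ℝ) (J : ℝ → Set ℝ) : Prop where
  eq_Ico : ∀ c, ∃ a b, a ≤ x ∧ x ≤ b ∧ J c = Ico a b
  measure_eq : ∀ c, w (J c) = ENNReal.ofReal c
  mono : ∀ c c', 0 < c → c ≤ c' → J c ⊆ J c'
  subset : ∀ c, J c ⊆ D
  subset_uIcc : ∀ c, ∀ y ∈ D, y ∉ J c → J c ⊆ uIcc x y

theorem exists_oneSidedFamily_Ici (w : Measure ℝ) [IsLocallyFiniteMeasure w]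
    [NullSingletonClass w] (x : ℝ) (h : w (Ici x) = ∞) : ∃ J, OneSidedFamily w x (Ici x) J := by
  refine ⟨fun c => Ico x (sInf {b : ℝ | x ≤ b ∧ ENNReal.ofReal c ≤ w (Ico x b)}),
    fun c => ⟨x, _, le_rfl, (measure_Ico_sInf w x h c).1, rfl⟩,
    fun c => (measure_Ico_sInf w x h c).2, fun c c' hc hcc' => ?_,
    fun c => Ico_subset_Ici_self, fun c y hy hyJ z hz => ?_⟩
  · rcases hcc'.eq_or_lt with rfl | hlt
    · rfl
    refine Ico_subset_Ico_right (le_of_not_gt fun hcon => ?_)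
    have := measure_mono (μ := w) (Ico_subset_Ico (le_refl x) hcon.le)
    rw [(measure_Ico_sInf w x h c).2, (measure_Ico_sInf w x h c').2,
      ENNReal.ofReal_le_ofReal_iff hc.le] at this
    linarith
  · rw [uIcc_of_le hy]
    simp only [mem_Ico, not_and, not_lt] at hyJ
    exact ⟨hz.1, hz.2.le.trans (hyJ hy)⟩

theorem exists_oneSidedFamily_Iio (w : Measure ℝ) [IsLocallyFiniteMeasure w]
    [NullSingletonClass w] (x : ℝ) (h : w (Iio x) = ∞) : ∃ J, OneSidedFamily w x (Iio x) J := by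
  refine ⟨fun c => Ico (sSup {b : ℝ | b ≤ x ∧ ENNReal.ofReal c ≤ w (Ico b x)}) x,
    fun c => ⟨_, x, (measure_Ico_sSup w x h c).1, le_rfl, rfl⟩,
    fun c => (measure_Ico_sSup w x h c).2, fun c c' hc hcc' => ?_,
    fun c z hz => hz.2, fun c y hy hyJ z hz => ?_⟩
  · rcases hcc'.eq_or_lt with rfl | hlt
    · rfl
    refine Ico_subset_Ico_left (le_of_not_gt fun hcon => ?_)
    have := measure_mono (μ := w) (Ico_subset_Ico hcon.le (le_refl x))
    rw [(measure_Ico_sSup w x h c).2, (measure_Ico_sSup w x h c').2,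
      ENNReal.ofReal_le_ofReal_iff hc.le] at this
    linarith
  · rw [uIcc_of_ge (le_of_lt hy)]
    have : y < sSup {b : ℝ | b ≤ x ∧ ENNReal.ofReal c ≤ w (Ico b x)} :=
      lt_of_not_ge fun hle => hyJ ⟨hle, hy⟩
    exact ⟨this.le.trans hz.1, hz.2.le⟩

namespace OneSidedFamily

variable {w : Measure ℝ} {x : ℝ} {D : Set ℝ} {J : ℝ → Set ℝ}

theorem measurableSet (hJ : OneSidedFamily w x D J) (c : ℝ) : MeasurableSet (J c) := by
  obtain ⟨a, b, -, -, h⟩ := hJ.eq_Ico c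
  exact h ▸ measurableSet_Ico

theorem mem_of_measure_uIcc_lt (hJ : OneSidedFamily w x D J) {y : ℝ} (hy : y ∈ D) {c : ℝ}
    (hc : w (uIcc x y) < ENNReal.ofReal c) : y ∈ J c := by
  by_contra hyJ
  exact hc.not_ge (hJ.measure_eq c ▸ measure_mono (hJ.subset_uIcc c y hy hyJ))

theorem notMem_of_lt_measure_uIcc [NullSingletonClass w] (hJ : OneSidedFamily w x D J) {y : ℝ}
    {c : ℝ} (hc : ENNReal.ofReal c < w (uIcc x y)) : y ∉ J c := by
  intro hyJ
  obtain ⟨a, b, hax, hxb, h⟩ := hJ.eq_Ico c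
  rw [← hJ.measure_eq c, h, measure_congr Ico_ae_eq_Icc] at hc
  rw [h] at hyJ
  refine hc.not_ge (measure_mono ?_)
  exact uIcc_subset_Icc ⟨hax, hxb⟩ ⟨hyJ.1, hyJ.2.le⟩

/-- Two-sided geometric exhaustion. -/
theorem exists_mem_sdiff [IsLocallyFiniteMeasure w] (hJ : OneSidedFamily w x D J) {a c : ℝ}
    (ha : 1 < a) (hc : 0 < c) {y : ℝ} (hy : y ∈ D) (hyJ : ∃ j : ℤ, y ∉ J (c * a ^ j)) :
    ∃ j : ℤ, y ∈ J (c * a ^ (j + 1)) \ J (c * a ^ j) := by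
  have ha0 : 0 < a := by linarith
  have hmono : ∀ i j : ℤ, i ≤ j → J (c * a ^ i) ⊆ J (c * a ^ j) := fun i j hij =>
    hJ.mono _ _ (by positivity) (by
      have := zpow_le_zpow_right₀ ha.le hij
      gcongr)
  obtain ⟨n, hn⟩ := pow_unbounded_of_one_lt ((w (uIcc x y)).toReal / c) ha
  have hmem : y ∈ J (c * a ^ (n : ℤ)) := by
    refine hJ.mem_of_measure_uIcc_lt hy ?_
    rw [ENNReal.lt_ofReal_iff_toReal_lt isCompact_uIcc.measure_lt_top.ne, zpow_natCast]
    rw [div_lt_iff₀ hc] at hn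
    linarith
  -- This hypothesis cannot be dropped: if `w` vanishes near `x`, nearby points of `D` lie in every
  -- `J (c * a ^ j)`. Where it holds, the least index whose interval contains `y` determines the
  -- shell.
  obtain ⟨j₀, hj₀⟩ := hyJ
  obtain ⟨m, hm, hmmin⟩ := Int.exists_least_of_bdd (P := fun j : ℤ => y ∈ J (c * a ^ j))
    ⟨j₀, fun z hz => le_of_not_gt fun hlt => hj₀ (hmono _ _ hlt.le hz)⟩ ⟨n, hmem⟩
  refine ⟨m - 1, by simpa using hm, fun hcon => ?_⟩
  have := hmmin _ hcon
  omega

/-- One-sided geometric exhaustion. -/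
theorem exists_mem_sdiff_nat [IsLocallyFiniteMeasure w] (hJ : OneSidedFamily w x D J) {c : ℝ}
    (hc : 0 < c) {y : ℝ} (hy : y ∈ D) (hyJ : y ∉ J c) :
    ∃ n : ℕ, y ∈ J (c * 2 ^ (n + 1)) \ J (c * 2 ^ n) := by
  classical
  obtain ⟨n, hn⟩ := pow_unbounded_of_one_lt ((w (uIcc x y)).toReal / c) one_lt_two
  have hex : ∃ n : ℕ, y ∈ J (c * 2 ^ n) := by
    refine ⟨n, hJ.mem_of_measure_uIcc_lt hy ?_⟩
    rw [ENNReal.lt_ofReal_iff_toReal_lt isCompact_uIcc.measure_lt_top.ne]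
    rw [div_lt_iff₀ hc] at hn
    linarith
  obtain ⟨m, hm⟩ : ∃ m, Nat.find hex = m + 1 := Nat.exists_eq_succ_of_ne_zero fun h0 => by
    have := Nat.find_spec hex
    rw [h0] at this
    simp only [pow_zero, mul_one] at this
    exact hyJ this
  exact ⟨m, hm ▸ Nat.find_spec hex, Nat.find_min hex (by omega)⟩

end OneSidedFamily

/-! ### The weighted weak-type inequality -/

/-- Bound for a kernel integral over a region split into shells `U i \ V i`. -/
theorem lintegral_kernel_le_tsum {ι : Type*} [Countable ι] (μ : Measure ℝ) (g f : ℝ → ℝ≥0∞)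
    (hf : AEMeasurable f μ) (κ : ℝ) (M : ℝ≥0∞) (D : Set ℝ) (U V : ι → Set ℝ)
    (hU : ∀ i, MeasurableSet (U i)) (hV : ∀ i, MeasurableSet (V i))
    (hcov : D ≤ᵐ[μ] ⋃ i, U i \ V i) (hV0 : ∀ i, μ (V i) ≠ 0) (hVt : ∀ i, μ (V i) ≠ ∞)
    (hg : ∀ i, ∀ y ∈ U i \ V i, g y * μ (V i) ^ κ ≤ M) :
    ∫⁻ y in D, g y * f y ∂μ ≤ ∑' i, M * μ (V i) ^ (-κ) * ∫⁻ y in U i, f y ∂μ := by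
  calc ∫⁻ y in D, g y * f y ∂μ ≤ ∫⁻ y in ⋃ i, U i \ V i, g y * f y ∂μ :=
        lintegral_mono_set' hcov
    _ ≤ ∑' i, ∫⁻ y in U i \ V i, g y * f y ∂μ := lintegral_iUnion_le _ _
    _ ≤ ∑' i, M * μ (V i) ^ (-κ) * ∫⁻ y in U i, f y ∂μ := by
        refine ENNReal.tsum_le_tsum fun i => ?_
        calc ∫⁻ y in U i \ V i, g y * f y ∂μ
            ≤ ∫⁻ y in U i \ V i, M * μ (V i) ^ (-κ) * f y ∂μ := by
              refine setLIntegral_mono' ((hU i).diff (hV i)) fun y hy => ?_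
              gcongr
              calc g y = g y * μ (V i) ^ κ * μ (V i) ^ (-κ) := by
                    rw [mul_assoc, ← ENNReal.rpow_add _ _ (hV0 i) (hVt i)]; simp
                _ ≤ M * μ (V i) ^ (-κ) := by gcongr; exact hg i y hy
          _ = M * μ (V i) ^ (-κ) * ∫⁻ y in U i \ V i, f y ∂μ :=
              lintegral_const_mul'' _ hf.restrict
          _ ≤ _ := by gcongr; exact sdiff_subset

/-- The geometric weights in the estimate of a kernel integral over shells. -/
noncomputable def shellFactor (a d p : ℝ) (i : ℤ) : ℝ := (a ^ i) ^ (-d) * (min 1 (a ^ i)) ^ p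

/-- The factor is `a^(-d i)` for `i ≥ 0` and `a^((p - d) i)` for `i ≤ 0`: two geometric series,
converging because `d > 0` and `p > d` respectively. With `d = 1/θ` and `p = 1/P` this is where `P <
θ` is needed. -/
theorem summable_shellFactor {a d p : ℝ} (ha : 1 < a) (hd : 0 < d) (hdp : d < p) :
    Summable (shellFactor a d p) := by
  have ha0 : 0 < a := by linarith
  refine Summable.of_nat_of_neg ?_ ?_
  · refine (summable_geometric_of_lt_one (r := a ^ (-d)) (by positivity)
      (Real.rpow_lt_one_of_one_lt_of_neg ha (by linarith))).congr fun n => ?_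
    rw [shellFactor, zpow_natCast, min_eq_left (one_le_pow₀ ha.le), Real.one_rpow, mul_one,
      ← Real.rpow_natCast, ← Real.rpow_natCast, ← Real.rpow_mul ha0.le, ← Real.rpow_mul ha0.le,
      mul_comm]
  · refine (summable_geometric_of_lt_one (r := a ^ (-(p - d))) (by positivity)
      (Real.rpow_lt_one_of_one_lt_of_neg ha (by linarith))).congr fun n => ?_
    have h1 : a ^ (-(n : ℤ)) ≤ 1 := zpow_le_one_of_nonpos₀ ha.le (by simp)
    rw [shellFactor, min_eq_right h1, ← Real.rpow_add (by positivity), ← Real.rpow_natCast,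
      ← Real.rpow_intCast, ← Real.rpow_mul ha0.le, ← Real.rpow_mul ha0.le]
    congr 1; push_cast; ring

theorem tsum_shellFactor_ne_top {a d p : ℝ} (ha : 1 < a) (hd : 0 < d) (hdp : d < p) :
    ∑' i : ℤ, ENNReal.ofReal (shellFactor a d p (i + 1)) ≠ ∞ := by
  have h := (summable_shellFactor ha hd hdp)
  have ha0 : 0 < a := by linarith
  have hnn : ∀ i, 0 ≤ shellFactor a d p (i + 1) := fun i => by unfold shellFactor; positivity
  have h' : Summable fun i : ℤ => shellFactor a d p (i + 1) :=
    (Equiv.addRight (1 : ℤ)).summable_iff.2 h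
  rw [← ENNReal.ofReal_tsum_of_nonneg hnn h']
  exact ENNReal.ofReal_ne_top

theorem ofReal_zpow_ne_zero {a c : ℝ} (ha : 0 < a) (hc : 0 < c) (i : ℤ) :
    ENNReal.ofReal (c * a ^ i) ≠ 0 := by
  have : 0 < c * a ^ i := by positivity
  simpa using this

/-- Kernel integral over a half line, when `(f v) ^ P` has small averages relative to the weight
over all intervals touching `x`. -/
theorem AverageBound.lintegral_kernel_side_le {μ : Measure ℝ} [IsLocallyFiniteMeasure μ]
    {v : ℝ → ℝ≥0} {θ κ P : ℝ} {C : ℝ≥0} (h : AverageBound μ v θ κ P C)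
    (hκ : 0 < κ) (hP : 0 < P) (hθ : 0 < θ)
    [IsLocallyFiniteMeasure (weight μ v θ)] (hac : μ ≪ weight μ v θ) {a : ℝ} (ha : 1 < a)
    (hB : ∀ (l r : ℝ) (T : Set ℝ), MeasurableSet T → T ⊆ Ico l r →
      weight μ v θ (Ico l r) ≠ 0 → weight μ v θ (Ico l r) ≤ ENNReal.ofReal a * weight μ v θ T →
      μ (Ico l r) ≤ 2 * μ T)
    (k : ℝ → ℝ≥0∞) (M : ℝ≥0∞) (hk : ∀ x y, k (x - y) * μ (uIcc x y) ^ κ ≤ M)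
    (f : ℝ → ℝ≥0∞) (hf : AEMeasurable f μ) (x : ℝ) (D : Set ℝ) (J : ℝ → Set ℝ)
    (hJ : OneSidedFamily (weight μ v θ) x D J) (c : ℝ) (hc : 0 < c) (n : ℝ≥0∞)
    (hn : ∫⁻ y, (f y * v y) ^ P ∂μ ≤ n)
    (hsmall : ∀ l r, l ≤ x → x ≤ r → ∫⁻ y in Ico l r, (f y * v y) ^ P ∂μ ≤
      n / ENNReal.ofReal c * weight μ v θ (Ico l r)) :
    ∫⁻ y in D, k (x - y) * f y ∂μ ≤ M * 2 ^ κ * C *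
      (∑' i : ℤ, ENNReal.ofReal (shellFactor a (1 / θ) (1 / P) (i + 1))) *
        (ENNReal.ofReal c ^ (-(1 / θ)) * n ^ (1 / P)) := by
  have ha0 : 0 < a := by linarith
  set w := weight μ v θ with hw
  have hwμ : w ≪ μ := weight_absolutelyContinuous μ v θ
  have hwpos : ∀ i : ℤ, w (J (c * a ^ i)) ≠ 0 := fun i => by
    rw [hJ.measure_eq]; exact ofReal_zpow_ne_zero ha0 hc i
  have hμpos : ∀ i : ℤ, μ (J (c * a ^ i)) ≠ 0 := fun i h0 => hwpos i (hwμ h0)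
  have hμfin : ∀ i : ℤ, μ (J (c * a ^ i)) ≠ ∞ := fun i => by
    obtain ⟨l, r, -, -, hlr⟩ := hJ.eq_Ico (c * a ^ i)
    rw [hlr]; exact measure_Ico_lt_top.ne
  -- The points in no shell lie in intervals of arbitrarily small weight, so they form a `w`-null
  -- set, which is `μ`-null by `hac`.
  have hnull : μ (⋂ i : ℤ, J (c * a ^ i)) = 0 := by
    refine hac ?_
    refine le_antisymm (le_of_forall_gt fun ε hε => ?_) zero_le
    obtain ⟨e, he0, heε⟩ := ENNReal.lt_iff_exists_nnreal_btwn.1 hε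
    have he0' : (0 : ℝ) < e := by exact_mod_cast he0
    obtain ⟨m, hm⟩ := exists_pow_lt_of_lt_one (div_pos he0' hc) (inv_lt_one_of_one_lt₀ ha)
    calc w (⋂ i : ℤ, J (c * a ^ i)) ≤ w (J (c * a ^ (-(m : ℤ)))) :=
          measure_mono (iInter_subset _ _)
      _ = ENNReal.ofReal (c * a ^ (-(m : ℤ))) := hJ.measure_eq _
      _ ≤ ENNReal.ofReal e := by
          refine ENNReal.ofReal_le_ofReal ?_
          rw [lt_div_iff₀ hc] at hm
          rw [zpow_neg, zpow_natCast, ← inv_pow]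
          linarith
      _ = e := ENNReal.ofReal_coe_nnreal
      _ < ε := heε
  have hcov : D ≤ᵐ[μ] ⋃ i : ℤ, J (c * a ^ (i + 1)) \ J (c * a ^ i) := by
    filter_upwards [compl_mem_ae_iff.2 hnull] with y hy hyD
    have : ∃ j : ℤ, y ∉ J (c * a ^ j) := by simpa using hy
    obtain ⟨j, hj⟩ := hJ.exists_mem_sdiff ha hc hyD this
    exact mem_iUnion.2 ⟨j, hj⟩
  have hkD : ∀ i : ℤ, ∀ y ∈ J (c * a ^ (i + 1)) \ J (c * a ^ i),
      k (x - y) * μ (J (c * a ^ i)) ^ κ ≤ M := fun i y hy => by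
    refine le_trans ?_ (hk x y)
    gcongr
    exact hJ.subset_uIcc _ y (hJ.subset _ hy.1) hy.2
  have hterm : ∀ i : ℤ, M * μ (J (c * a ^ i)) ^ (-κ) * ∫⁻ y in J (c * a ^ (i + 1)), f y ∂μ ≤
      M * 2 ^ κ * C * ENNReal.ofReal (shellFactor a (1 / θ) (1 / P) (i + 1)) *
        (ENNReal.ofReal c ^ (-(1 / θ)) * n ^ (1 / P)) := by
    intro i
    have hai : 0 < a ^ (i + 1) := by positivity
    obtain ⟨l, r, hlx, hxr, hlr⟩ := hJ.eq_Ico (c * a ^ (i + 1))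
    have hwU := hJ.measure_eq (c * a ^ (i + 1))
    set U := J (c * a ^ (i + 1)) with hU
    set V := J (c * a ^ i) with hV
    have hVU : V ⊆ U := hJ.mono _ _ (by positivity) (by
      have := zpow_le_zpow_right₀ ha.le (show i ≤ i + 1 by omega)
      gcongr)
    -- The ratio of the weights is exactly `a`, so `V` carries the share `1/a` of `U`. The kernel
    -- bound involves the inner interval `V` and the average bound the outer one `U`; this
    -- inequality links them.
    have hμU : μ U ≤ 2 * μ V := by
      rw [hlr]
      refine hB l r V (hJ.measurableSet _) (hlr ▸ hVU) (hlr ▸ hwpos (i + 1)) ?_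
      rw [← hlr, hwU, hJ.measure_eq, ← ENNReal.ofReal_mul ha0.le, zpow_add_one₀ ha0.ne']
      exact ENNReal.ofReal_le_ofReal (le_of_eq (by ring))
    have hμ2 : μ V ^ (-κ) ≤ 2 ^ κ * μ U ^ (-κ) := by
      have h2 : (2 : ℝ≥0∞) ^ κ ≠ 0 := by simp [ENNReal.rpow_eq_zero_iff]
      have h2t : (2 : ℝ≥0∞) ^ κ ≠ ∞ := ENNReal.rpow_ne_top_of_nonneg hκ.le (by simp)
      rw [ENNReal.rpow_neg, ENNReal.rpow_neg]
      calc (μ V ^ κ)⁻¹ = 2 ^ κ * ((2 ^ κ)⁻¹ * (μ V ^ κ)⁻¹) := by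
            rw [← mul_assoc, ENNReal.mul_inv_cancel h2 h2t, one_mul]
        _ = 2 ^ κ * ((2 * μ V) ^ κ)⁻¹ := by
            rw [ENNReal.mul_rpow_of_nonneg _ _ hκ.le, ENNReal.mul_inv (Or.inl h2) (Or.inl h2t)]
        _ ≤ 2 ^ κ * (μ U ^ κ)⁻¹ := by gcongr
    have hwU0 : w U ≠ 0 := hwpos (i + 1)
    have hwUt : w U ≠ ∞ := by rw [hwU]; exact ENNReal.ofReal_ne_top
    have hμU0 : μ U ≠ 0 := hμpos (i + 1)
    have hμUt : μ U ≠ ∞ := hμfin (i + 1)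
    have hH := h l r f hf
    rw [← weight_apply, ← hlr] at hH
    have hH' : μ U ^ (-κ) * ∫⁻ y in U, f y ∂μ ≤
        C * (w U ^ (-(1 / θ)) * (∫⁻ y in U, (f y * v y) ^ P ∂μ) ^ (1 / P)) := by
      calc μ U ^ (-κ) * ∫⁻ y in U, f y ∂μ
          = μ U ^ (-κ) * w U ^ (-(1 / θ)) * (w U ^ (1 / θ) * ∫⁻ y in U, f y ∂μ) := by
            have : w U ^ (-(1 / θ)) * w U ^ (1 / θ) = 1 := by
              rw [← ENNReal.rpow_add _ _ hwU0 hwUt]; simp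
            calc _ = μ U ^ (-κ) * (w U ^ (-(1 / θ)) * w U ^ (1 / θ)) * ∫⁻ y in U, f y ∂μ := by
                  rw [this, mul_one]
              _ = _ := by ring
        _ ≤ μ U ^ (-κ) * w U ^ (-(1 / θ)) *
              (C * μ U ^ κ * (∫⁻ y in U, (f y * v y) ^ P ∂μ) ^ (1 / P)) := by gcongr
        _ = (μ U ^ (-κ) * μ U ^ κ) *
              (C * (w U ^ (-(1 / θ)) * (∫⁻ y in U, (f y * v y) ^ P ∂μ) ^ (1 / P))) := by ring
        _ = _ := by rw [← ENNReal.rpow_add _ _ hμU0 hμUt]; simp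
    -- Intervals of weight at least `c` use the total mass `n`; smaller ones use the smallness
    -- hypothesis, which gives `(n/c) w(U) = n a^(i+1)`.
    have hν : ∫⁻ y in U, (f y * v y) ^ P ∂μ ≤ n * ENNReal.ofReal (min 1 (a ^ (i + 1))) := by
      rcases le_total 1 (a ^ (i + 1)) with h1 | h1
      · rw [min_eq_left h1, ENNReal.ofReal_one, mul_one]
        exact (setLIntegral_le_lintegral _ _).trans hn
      · rw [min_eq_right h1]
        refine (hlr ▸ hsmall l r hlx hxr).trans (le_of_eq ?_)
        have hc' : ENNReal.ofReal c ≠ 0 := by simpa using hc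
        rw [hwU, ENNReal.ofReal_mul hc.le, ← mul_assoc,
          ENNReal.div_mul_cancel hc' ENNReal.ofReal_ne_top]
    have hfac : w U ^ (-(1 / θ)) * (∫⁻ y in U, (f y * v y) ^ P ∂μ) ^ (1 / P) ≤
        ENNReal.ofReal (shellFactor a (1 / θ) (1 / P) (i + 1)) *
          (ENNReal.ofReal c ^ (-(1 / θ)) * n ^ (1 / P)) := by
      calc w U ^ (-(1 / θ)) * (∫⁻ y in U, (f y * v y) ^ P ∂μ) ^ (1 / P)
          ≤ w U ^ (-(1 / θ)) * (n * ENNReal.ofReal (min 1 (a ^ (i + 1)))) ^ (1 / P) := by gcongr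
        _ = _ := by
            have hmin : 0 < min 1 (a ^ (i + 1)) := lt_min one_pos hai
            rw [hwU, ENNReal.ofReal_mul hc.le,
              ENNReal.mul_rpow_of_ne_top ENNReal.ofReal_ne_top ENNReal.ofReal_ne_top,
              ENNReal.mul_rpow_of_nonneg _ _ (by positivity),
              shellFactor, ENNReal.ofReal_mul (by positivity), ENNReal.ofReal_rpow_of_pos hai,
              ENNReal.ofReal_rpow_of_pos hmin]
            ring
    calc M * μ V ^ (-κ) * ∫⁻ y in U, f y ∂μ
        ≤ M * (2 ^ κ * μ U ^ (-κ)) * ∫⁻ y in U, f y ∂μ := by gcongr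
      _ = M * 2 ^ κ * (μ U ^ (-κ) * ∫⁻ y in U, f y ∂μ) := by ring
      _ ≤ M * 2 ^ κ * (C * (ENNReal.ofReal (shellFactor a (1 / θ) (1 / P) (i + 1)) *
          (ENNReal.ofReal c ^ (-(1 / θ)) * n ^ (1 / P)))) := by
          exact mul_le_mul' le_rfl (hH'.trans (mul_le_mul' le_rfl hfac))
      _ = _ := by ring
  refine (lintegral_kernel_le_tsum μ _ f hf κ M D (fun i : ℤ => J (c * a ^ (i + 1)))
    (fun i : ℤ => J (c * a ^ i)) (fun _ => hJ.measurableSet _) (fun _ => hJ.measurableSet _)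
    hcov hμpos hμfin hkD).trans ((ENNReal.tsum_le_tsum hterm).trans (le_of_eq ?_))
  rw [ENNReal.tsum_mul_right, ENNReal.tsum_mul_left]

/-- At a point where no interval has a large ratio of `∫ (f v)^P` to weight, the shell estimate on
both sides gives `Kf ≤ t`. So the level set lies where the maximal function relative to `w` is
large, and only the weak type (1, 1) of the latter is needed. -/
theorem AverageBound.exists_weak_type {μ : Measure ℝ} [IsLocallyFiniteMeasure μ]
    [NullSingletonClass μ] (hμ : ∀ a : ℝ, μ (Iio a) = ∞ ∧ μ (Ici a) = ∞)
    {v : ℝ → ℝ≥0} {θ κ P : ℝ} {C : ℝ≥0} (h : AverageBound μ v θ κ P C) (hv : AEMeasurable v μ)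
    (hκ : 0 < κ) (hP : 0 < P) (hPθ : P < θ) (hκP : κ = 1 / θ + 1 - 1 / P)
    (k : ℝ → ℝ≥0∞) (M : ℝ≥0∞) (hM : M ≠ ∞) (hk : ∀ x y, k (x - y) * μ (uIcc x y) ^ κ ≤ M) :
    ∃ C' : ℝ≥0, 0 < C' ∧ ∀ f : ℝ → ℝ≥0∞, AEMeasurable f μ → ∀ t : ℝ≥0, 0 < t →
      weight μ v θ {x | (t : ℝ≥0∞) < ∫⁻ y, k (x - y) * f y ∂μ} ^ (1 / θ) ≤
        C' * ((t : ℝ≥0∞)⁻¹ * (∫⁻ y, (f y * v y) ^ P ∂μ) ^ (1 / P)) := by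
  have hθ : 0 < θ := hP.trans hPθ
  rcases eq_or_ne (weight μ v θ univ) 0 with hw0 | hw0
  · refine ⟨1, one_pos, fun f _ t _ => ?_⟩
    rw [measure_mono_null (subset_univ _) hw0, ENNReal.zero_rpow_of_pos (by positivity)]
    exact zero_le
  have := h.isLocallyFiniteMeasure_weight hv hθ hκ hP
  have hac := h.absolutelyContinuous_weight hv hκ hP hPθ hκP hw0
  have htop := h.weight_eq_top hv hκ hP hPθ hκP hw0 hμ
  obtain ⟨a, ha, hB⟩ := h.exists_measure_le_two_mul hv hκ hP hPθ hκP
  simp only [← weight_apply] at hB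
  set w := weight μ v θ with hw
  set A : ℝ≥0∞ := M * 2 ^ κ * C *
      (∑' i : ℤ, ENNReal.ofReal (shellFactor a (1 / θ) (1 / P) (i + 1))) with hA
  have hAt : A ≠ ∞ := by
    refine ENNReal.mul_ne_top (ENNReal.mul_ne_top (ENNReal.mul_ne_top hM
      (ENNReal.rpow_ne_top_of_nonneg hκ.le (by simp))) ENNReal.coe_ne_top)
      (tsum_shellFactor_ne_top ha (by positivity) (by gcongr))
  obtain ⟨A', hA'⟩ : ∃ A' : ℝ≥0, (A' : ℝ≥0∞) = A := ⟨_, ENNReal.coe_toNNReal hAt⟩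
  set L : ℝ≥0 := 2 * A' + 1 with hL
  have hL0 : 0 < L := by positivity
  refine ⟨3 ^ (1 / θ) * L, by positivity, fun f hf t ht => ?_⟩
  set n := ∫⁻ y, (f y * v y) ^ P ∂μ with hn
  have ht0 : (t : ℝ≥0∞) ≠ 0 := by exact_mod_cast ht.ne'
  rcases eq_or_ne n ∞ with hnt | hnt
  · rw [hnt, ENNReal.top_rpow_of_pos (by positivity), ENNReal.mul_top (by simp),
      ENNReal.mul_top (by positivity)]
    exact le_top
  have hfvm : AEMeasurable (fun y => (f y * v y) ^ P) μ :=
    (hf.mul hv.coe_nnreal_ennreal).pow_const P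
  -- The covering threshold `n / c` would vanish here. Since a nontrivial weight is positive almost
  -- everywhere, `f` is null and the level set is empty.
  rcases eq_or_ne n 0 with hn0 | hn0
  · have hv0 : ∀ᵐ y ∂μ, v y ≠ 0 := by
      have hwz : ∀ᵐ y ∂w, (v y : ℝ≥0∞) ^ θ ≠ 0 := by
        rw [hw, weight, ae_withDensity_iff' (hv.coe_nnreal_ennreal.pow_const θ)]
        exact Eventually.of_forall fun _ h => h
      filter_upwards [hac.ae_le hwz] with y hy h0
      exact hy (by rw [h0, ENNReal.coe_zero, ENNReal.zero_rpow_of_pos hθ])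
    have hf0 : ∀ᵐ y ∂μ, f y = 0 := by
      rw [hn, lintegral_eq_zero_iff' hfvm] at hn0
      filter_upwards [hn0, hv0] with y hy hvy
      rw [Pi.zero_apply, ENNReal.rpow_eq_zero_iff_of_pos hP, mul_eq_zero] at hy
      exact hy.resolve_right (by exact_mod_cast hvy)
    have hempty : {x | (t : ℝ≥0∞) < ∫⁻ y, k (x - y) * f y ∂μ} = ∅ := by
      refine eq_empty_of_forall_notMem fun x hx => ?_
      have : ∫⁻ y, k (x - y) * f y ∂μ = 0 := by
        rw [lintegral_congr_ae (g := fun _ => 0) (by filter_upwards [hf0] with y hy; simp [hy])]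
        simp
      rw [mem_ofPred_eq, this] at hx
      exact not_lt_zero hx
    rw [hempty, measure_empty, ENNReal.zero_rpow_of_pos (by positivity)]
    exact zero_le
  set N := n ^ (1 / P) with hN
  have hN0 : N ≠ 0 := by
    rw [hN, Ne, ENNReal.rpow_eq_zero_iff_of_pos (by positivity)]; exact hn0
  have hNt : N ≠ ∞ := ENNReal.rpow_ne_top_of_nonneg (by positivity) hnt
  obtain ⟨N', hN'⟩ : ∃ N' : ℝ≥0, (N' : ℝ≥0∞) = N := ⟨_, ENNReal.coe_toNNReal hNt⟩
  have hN'0 : 0 < N' := pos_iff_ne_zero.2 fun h0 => hN0 (by rw [← hN', h0, ENNReal.coe_zero])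
  -- Chosen so that `L c^(-1/θ) N = t`. As `L = 2 A' + 1`, the two half-line bounds `A c^(-1/θ) N`
  -- add up to at most `t`.
  set c : ℝ≥0 := (L * (t⁻¹ * N')) ^ θ with hc
  have hc0 : 0 < c := by positivity
  have hcθ : (c : ℝ≥0∞) ^ (1 / θ) = L * ((t : ℝ≥0∞)⁻¹ * N) := by
    rw [← hN', hc, ← ENNReal.coe_rpow_of_nonneg _ (by positivity), ← NNReal.rpow_mul,
      mul_one_div_cancel hθ.ne', NNReal.rpow_one, ENNReal.coe_mul, ENNReal.coe_mul,
      ENNReal.coe_inv ht.ne']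
  have hc0' : (c : ℝ≥0∞) ≠ 0 := by exact_mod_cast hc0.ne'
  set ν := μ.withDensity (fun y => (f y * v y) ^ P) with hν
  have hνapp : ∀ s, ν s = ∫⁻ y in s, (f y * v y) ^ P ∂μ := fun s => withDensity_apply' _ _
  have hcov := mul_measure_le_of_forall_exists_Ico ν w (n / c) (ENNReal.div_ne_zero.2
    ⟨hn0, ENNReal.coe_ne_top⟩) (ENNReal.div_ne_top hnt hc0')
    {x | (t : ℝ≥0∞) < ∫⁻ y, k (x - y) * f y ∂μ} (by
      intro x hx
      by_contra hcon
      push Not at hcon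
      refine not_le_of_gt (show (t : ℝ≥0∞) < ∫⁻ y, k (x - y) * f y ∂μ from hx) ?_
      have hsmall : ∀ l r, l ≤ x → x ≤ r → ∫⁻ y in Ico l r, (f y * v y) ^ P ∂μ ≤
          n / ENNReal.ofReal c * w (Ico l r) := fun l r hl hr => by
        rw [← hνapp, ENNReal.ofReal_coe_nnreal]; exact hcon l r hl hr
      obtain ⟨J, hJ⟩ := exists_oneSidedFamily_Ici w x (htop x).2
      obtain ⟨J', hJ'⟩ := exists_oneSidedFamily_Iio w x (htop x).1
      have h1 := h.lintegral_kernel_side_le hκ hP hθ hac ha hB k M hk f hf x _ J hJ c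
        (by exact_mod_cast hc0) n le_rfl hsmall
      have h2 := h.lintegral_kernel_side_le hκ hP hθ hac ha hB k M hk f hf x _ J' hJ' c
        (by exact_mod_cast hc0) n le_rfl hsmall
      rw [← hA, ENNReal.ofReal_coe_nnreal, ← hN] at h1 h2
      have hid : (L : ℝ≥0∞) * ((c : ℝ≥0∞) ^ (-(1 / θ)) * N) = t := by
        have hL' : (L : ℝ≥0∞) ≠ 0 := by exact_mod_cast hL0.ne'
        rw [ENNReal.rpow_neg, hcθ, ENNReal.mul_inv (Or.inl hL') (Or.inl ENNReal.coe_ne_top),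
          ENNReal.mul_inv (Or.inl (by simp)) (Or.inl (by simpa using ht.ne')), inv_inv]
        calc (L : ℝ≥0∞) * ((L : ℝ≥0∞)⁻¹ * (t * N⁻¹) * N)
            = (L * (L : ℝ≥0∞)⁻¹) * t * (N * N⁻¹) := by ring
          _ = t := by
              rw [ENNReal.mul_inv_cancel hL' ENNReal.coe_ne_top, ENNReal.mul_inv_cancel hN0 hNt]
              simp
      calc ∫⁻ y, k (x - y) * f y ∂μ
          = ∫⁻ y in Ici x, k (x - y) * f y ∂μ + ∫⁻ y in Iio x, k (x - y) * f y ∂μ := by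
            rw [← lintegral_add_compl _ (measurableSet_Ici (a := x)), compl_Ici]
        _ ≤ A * ((c : ℝ≥0∞) ^ (-(1 / θ)) * N) + A * ((c : ℝ≥0∞) ^ (-(1 / θ)) * N) :=
            add_le_add h1 h2
        _ = (2 * A) * ((c : ℝ≥0∞) ^ (-(1 / θ)) * N) := by ring
        _ ≤ L * ((c : ℝ≥0∞) ^ (-(1 / θ)) * N) := by
            gcongr
            rw [← hA', hL]
            push_cast
            exact le_self_add
        _ = t := hid)
  have hνn : ν univ = n := by rw [hνapp, Measure.restrict_univ]
  rw [hνn] at hcov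
  have hE : w {x | (t : ℝ≥0∞) < ∫⁻ y, k (x - y) * f y ∂μ} ≤ 3 * c := by
    rw [← ENNReal.mul_le_mul_iff_right hn0 hnt]
    calc n * w {x | (t : ℝ≥0∞) < ∫⁻ y, k (x - y) * f y ∂μ}
        = c * (n / c * w {x | (t : ℝ≥0∞) < ∫⁻ y, k (x - y) * f y ∂μ}) := by
          rw [← mul_assoc, ENNReal.mul_div_cancel hc0' ENNReal.coe_ne_top]
      _ ≤ c * (3 * n) := by gcongr
      _ = n * (3 * c) := by ring
  calc w {x | (t : ℝ≥0∞) < ∫⁻ y, k (x - y) * f y ∂μ} ^ (1 / θ) ≤ (3 * c : ℝ≥0∞) ^ (1 / θ) := by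
        gcongr
    _ = _ := by
        rw [ENNReal.mul_rpow_of_nonneg _ _ (by positivity), hcθ, ENNReal.coe_mul,
          ENNReal.coe_rpow_of_nonneg _ (by positivity)]
        push_cast
        ring

/-! ### The cells of a partition into intervals of equal measure -/

theorem cutPoint_strictMono (μ : Measure ℝ) [IsLocallyFiniteMeasure μ] [NullSingletonClass μ]
    (hμ : ∀ a : ℝ, μ (Iio a) = ∞ ∧ μ (Ici a) = ∞) (x₀ : ℝ) {r : ℝ} (hr : 0 < r) :
    StrictMono (cutPoint μ x₀ r) := by
  refine strictMono_int_of_lt_succ fun i => ?_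
  by_contra hcon
  have h := measure_cell μ hμ x₀ r hr i
  rw [cell, Ico_eq_empty_of_le (not_lt.1 hcon), measure_empty] at h
  have : 0 < ENNReal.ofReal r := by simpa using hr
  exact this.ne h

theorem exists_lt_cutPoint (μ : Measure ℝ) [IsLocallyFiniteMeasure μ] [NullSingletonClass μ]
    (hμ : ∀ a : ℝ, μ (Iio a) = ∞ ∧ μ (Ici a) = ∞) (x₀ : ℝ) {r : ℝ} (hr : 0 < r)
    (x : ℝ) : ∃ i : ℕ, x < cutPoint μ x₀ r i := by
  obtain ⟨n, hn⟩ := exists_nat_gt ((μ (Ico x₀ x)).toReal / r)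
  refine ⟨n, lt_of_not_ge fun hcon => ?_⟩
  have h := (measure_Ico_sInf μ x₀ (hμ x₀).2 (((n : ℤ) : ℝ) * r)).2
  have e : cutPoint μ x₀ r n =
      sInf {b : ℝ | x₀ ≤ b ∧ ENNReal.ofReal (((n : ℤ) : ℝ) * r) ≤ μ (Ico x₀ b)} := by
    rw [cutPoint, if_pos (by positivity)]
  rw [← e] at h
  have h2 := measure_mono (μ := μ) (Ico_subset_Ico (le_refl x₀) hcon)
  rw [h, ENNReal.ofReal_le_iff_le_toReal measure_Ico_lt_top.ne] at h2
  rw [div_lt_iff₀ hr] at hn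
  push_cast at h2
  linarith

theorem exists_cutPoint_lt (μ : Measure ℝ) [IsLocallyFiniteMeasure μ] [NullSingletonClass μ]
    (hμ : ∀ a : ℝ, μ (Iio a) = ∞ ∧ μ (Ici a) = ∞) (x₀ : ℝ) {r : ℝ} (hr : 0 < r)
    (x : ℝ) : ∃ i : ℕ, cutPoint μ x₀ r (-(i : ℤ) - 1) < x := by
  obtain ⟨n, hn⟩ := exists_nat_gt ((μ (Ico x x₀)).toReal / r)
  refine ⟨n, lt_of_not_ge fun hcon => ?_⟩
  have h := (measure_Ico_sSup μ x₀ (hμ x₀).1 (-((-(n : ℤ) - 1 : ℤ) : ℝ) * r)).2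
  have e : cutPoint μ x₀ r (-(n : ℤ) - 1) = sSup {b : ℝ | b ≤ x₀ ∧
      ENNReal.ofReal (-((-(n : ℤ) - 1 : ℤ) : ℝ) * r) ≤ μ (Ico b x₀)} := by
    rw [cutPoint, if_neg (by omega)]
  rw [← e] at h
  have h2 := measure_mono (μ := μ) (Ico_subset_Ico hcon (le_refl x₀))
  rw [h, ENNReal.ofReal_le_iff_le_toReal measure_Ico_lt_top.ne] at h2
  rw [div_lt_iff₀ hr] at hn
  push_cast at h2
  linarith

theorem exists_mem_cell (μ : Measure ℝ) [IsLocallyFiniteMeasure μ] [NullSingletonClass μ]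
    (hμ : ∀ a : ℝ, μ (Iio a) = ∞ ∧ μ (Ici a) = ∞) (x₀ : ℝ) {r : ℝ} (hr : 0 < r)
    (x : ℝ) : ∃ i, x ∈ cell μ x₀ r i := by
  obtain ⟨n, hn⟩ := exists_lt_cutPoint μ hμ x₀ hr x
  obtain ⟨m, hm⟩ := exists_cutPoint_lt μ hμ x₀ hr x
  have hmono := (cutPoint_strictMono μ hμ x₀ hr).monotone
  obtain ⟨i, hi, hmax⟩ := Int.exists_greatest_of_bdd (P := fun i : ℤ => cutPoint μ x₀ r i ≤ x)
    ⟨n, fun z hz => le_of_not_gt fun hlt => (hn.trans_le (hmono hlt.le)).not_ge hz⟩ ⟨_, hm.le⟩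
  refine ⟨i, hi, lt_of_not_ge fun hcon => ?_⟩
  have := hmax _ hcon
  omega

/-- An interval of measure at most `r` is covered by two adjacent cells. -/
theorem exists_setLIntegral_Ico_le_cell_add_cell (μ : Measure ℝ) [IsLocallyFiniteMeasure μ] [NullSingletonClass μ]
    (hμ : ∀ a : ℝ, μ (Iio a) = ∞ ∧ μ (Ici a) = ∞) (x₀ : ℝ) {r : ℝ} (hr : 0 < r)
    (a b : ℝ) (h : μ (Ico a b) ≤ ENNReal.ofReal r)
    (g : ℝ → ℝ≥0∞) :
    ∃ i, ∫⁻ y in Ico a b, g y ∂μ ≤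
      ∫⁻ y in cell μ x₀ r i, g y ∂μ + ∫⁻ y in cell μ x₀ r (i + 1), g y ∂μ := by
  obtain ⟨i, hi⟩ := exists_mem_cell μ hμ x₀ hr a
  refine ⟨i, ?_⟩
  have hmono := cutPoint_strictMono μ hμ x₀ hr
  -- The interval starts in cell `i`. If it goes past cell `i + 1`, that cell alone already has
  -- measure `r`, so only a null set can lie beyond.
  have hnull : μ (Ico (cutPoint μ x₀ r (i + 1 + 1)) b) = 0 := by
    rcases le_total b (cutPoint μ x₀ r (i + 1 + 1)) with hb | hb
    · rw [Ico_eq_empty_of_le hb, measure_empty]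
    have hdisj : Disjoint (cell μ x₀ r (i + 1)) (Ico (cutPoint μ x₀ r (i + 1 + 1)) b) :=
      Ico_disjoint_Ico_same
    have hsub : cell μ x₀ r (i + 1) ∪ Ico (cutPoint μ x₀ r (i + 1 + 1)) b ⊆ Ico a b := by
      refine union_subset (Ico_subset_Ico hi.2.le hb) (Ico_subset_Ico_left ?_)
      exact hi.2.le.trans (hmono.monotone (by omega))
    have h2 := (measure_mono (μ := μ) hsub).trans h
    rw [measure_union hdisj measurableSet_Ico, measure_cell μ hμ x₀ r hr] at h2
    by_contra h0
    exact (ENNReal.lt_add_right ENNReal.ofReal_ne_top h0).not_ge h2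
  have hsub : Ico a b ⊆ (cell μ x₀ r i ∪ cell μ x₀ r (i + 1)) ∪
      Ico (cutPoint μ x₀ r (i + 1 + 1)) b := by
    intro y hy
    rcases lt_or_ge y (cutPoint μ x₀ r (i + 1)) with h1 | h1
    · exact Or.inl (Or.inl ⟨hi.1.trans hy.1, h1⟩)
    rcases lt_or_ge y (cutPoint μ x₀ r (i + 1 + 1)) with h2 | h2
    · exact Or.inl (Or.inr ⟨h1, h2⟩)
    · exact Or.inr ⟨h2, hy.2⟩
  calc ∫⁻ y in Ico a b, g y ∂μ
      ≤ ∫⁻ y in (cell μ x₀ r i ∪ cell μ x₀ r (i + 1)) ∪ Ico (cutPoint μ x₀ r (i + 1 + 1)) b,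
          g y ∂μ := lintegral_mono_set hsub
    _ ≤ ∫⁻ y in cell μ x₀ r i ∪ cell μ x₀ r (i + 1), g y ∂μ +
          ∫⁻ y in Ico (cutPoint μ x₀ r (i + 1 + 1)) b, g y ∂μ := lintegral_union_le _ _ _
    _ = ∫⁻ y in cell μ x₀ r i ∪ cell μ x₀ r (i + 1), g y ∂μ := by
        rw [setLIntegral_measure_zero _ _ hnull, add_zero]
    _ ≤ _ := lintegral_union_le _ _ _

/-! ### Sequence inequalities -/

theorem rpow_add_add_le (x y z : ℝ≥0∞) {θ : ℝ} (hθ : 0 ≤ θ) :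
    (x + y + z) ^ θ ≤ 3 ^ θ * (x ^ θ + y ^ θ + z ^ θ) := by
  set u := max x (max y z) with hu
  have h : (x + y + z) ^ θ ≤ 3 ^ θ * u ^ θ := by
    rw [← ENNReal.mul_rpow_of_nonneg _ _ hθ]
    refine ENNReal.rpow_le_rpow ?_ hθ
    calc x + y + z ≤ u + u + u := by gcongr <;> simp [hu]
      _ = 3 * u := by ring
  refine h.trans ?_
  gcongr
  rcases max_choice x (max y z) with h1 | h1
  · rw [hu, h1]; exact le_self_add.trans le_self_add
  rcases max_choice y z with h2 | h2
  · rw [hu, h1, h2]; exact le_add_self.trans le_self_add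
  · rw [hu, h1, h2]; exact le_add_self

theorem tsum_rpow_add_neighbours_le (b : ℤ → ℝ≥0∞) {θ : ℝ} (hθ : 0 ≤ θ) :
    ∑' i : ℤ, (b (i - 1) + b i + b (i + 1)) ^ θ ≤ 3 ^ θ * 3 * ∑' i : ℤ, b i ^ θ := by
  calc ∑' i : ℤ, (b (i - 1) + b i + b (i + 1)) ^ θ
      ≤ ∑' i : ℤ, 3 ^ θ * (b (i - 1) ^ θ + b i ^ θ + b (i + 1) ^ θ) :=
        ENNReal.tsum_le_tsum fun i => rpow_add_add_le _ _ _ hθ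
    _ = 3 ^ θ * (∑' i : ℤ, b (i - 1) ^ θ + ∑' i : ℤ, b i ^ θ + ∑' i : ℤ, b (i + 1) ^ θ) := by
        rw [ENNReal.tsum_mul_left, ENNReal.tsum_add, ENNReal.tsum_add]
    _ = 3 ^ θ * 3 * ∑' i : ℤ, b i ^ θ := by
        have h1 : ∑' i : ℤ, b (i - 1) ^ θ = ∑' i : ℤ, b i ^ θ :=
          (Equiv.subRight (1 : ℤ)).tsum_eq (fun i => b i ^ θ)
        have h2 : ∑' i : ℤ, b (i + 1) ^ θ = ∑' i : ℤ, b i ^ θ :=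
          (Equiv.addRight (1 : ℤ)).tsum_eq (fun i => b i ^ θ)
        rw [h1, h2]
        ring

/-- Each term is at most the `ℓ^p` norm `B`, so `b_i^θ ≤ b_i^p B^(θ - p)`; summing gives `B^θ`. -/
theorem tsum_rpow_rpow_inv_anti {ι : Type*} (b : ι → ℝ≥0∞) {p θ : ℝ} (hp : 0 < p) (hpθ : p ≤ θ) :
    (∑' i, b i ^ θ) ^ (1 / θ) ≤ (∑' i, b i ^ p) ^ (1 / p) := by
  have hθ : 0 < θ := hp.trans_le hpθ
  set B := (∑' i, b i ^ p) ^ (1 / p) with hB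
  have hBp : B ^ p = ∑' i, b i ^ p := by
    rw [hB, ← ENNReal.rpow_mul, one_div_mul_cancel hp.ne', ENNReal.rpow_one]
  have hle : ∀ i, b i ≤ B := fun i => by
    rw [← ENNReal.rpow_le_rpow_iff hp, hBp]
    exact ENNReal.le_tsum i
  have h1 : ∑' i, b i ^ θ ≤ B ^ θ := by
    calc ∑' i, b i ^ θ ≤ ∑' i, b i ^ p * B ^ (θ - p) := by
          refine ENNReal.tsum_le_tsum fun i => ?_
          calc b i ^ θ = b i ^ p * b i ^ (θ - p) := by
                rw [← ENNReal.rpow_add_of_nonneg _ _ hp.le (by linarith)]; congr 1; ring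
            _ ≤ _ := by
                gcongr
                exact hle i
      _ = B ^ θ := by
          rw [ENNReal.tsum_mul_right, ← hBp,
            ← ENNReal.rpow_add_of_nonneg _ _ hp.le (by linarith)]
          congr 1; ring
  calc (∑' i, b i ^ θ) ^ (1 / θ) ≤ (B ^ θ) ^ (1 / θ) := by gcongr
    _ = B := by rw [← ENNReal.rpow_mul, mul_one_div_cancel hθ.ne', ENNReal.rpow_one]

/-! ### The weak-type inequality in amalgam norms -/

theorem tsum_two_pow_rpow_neg_ne_top {σ : ℝ} (hσ : 0 < σ) :
    ∑' n : ℕ, ENNReal.ofReal (((2 : ℝ) ^ (n + 1)) ^ (-σ)) ≠ ∞ := by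
  have h : Summable fun n : ℕ => ((2 : ℝ) ^ (n + 1)) ^ (-σ) := by
    refine ((summable_nat_add_iff 1).2 (summable_geometric_of_lt_one (r := (2 : ℝ) ^ (-σ))
      (by positivity) (Real.rpow_lt_one_of_one_lt_of_neg one_lt_two (by linarith)))).congr
      fun n => ?_
    rw [← Real.rpow_natCast, ← Real.rpow_natCast, ← Real.rpow_mul (by norm_num),
      ← Real.rpow_mul (by norm_num), mul_comm]
  rw [← ENNReal.ofReal_tsum_of_nonneg (fun n => by positivity) h]
  exact ENNReal.ofReal_ne_top

/-- Kernel integral over the part of a half line beyond `μ`-distance `c` from its end point. -/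
theorem lintegral_kernel_far_le (μ : Measure ℝ) [IsLocallyFiniteMeasure μ] [NullSingletonClass μ]
    (hμ : ∀ a : ℝ, μ (Iio a) = ∞ ∧ μ (Ici a) = ∞) (x₀ : ℝ) {κ σ Q d : ℝ} (hQ : 1 ≤ Q)
    (hσ : σ = κ - 1 + d) (k : ℝ → ℝ≥0∞) (M : ℝ≥0∞)
    (hk : ∀ x y, k (x - y) * μ (uIcc x y) ^ κ ≤ M) (hκ : 0 < κ) (f : ℝ → ℝ≥0∞)
    (hf : AEMeasurable f μ) (S : ℝ≥0∞)
    (hS : ∀ r : ℝ, 0 < r → ∀ i : ℤ, (∫⁻ y in cell μ x₀ r i, f y ^ Q ∂μ) ^ (1 / Q) ≤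
      S * ENNReal.ofReal r ^ (1 / Q - d))
    (x : ℝ) (D : Set ℝ) (J : ℝ → Set ℝ) (hJ : OneSidedFamily μ x D J) (c : ℝ) (hc : 0 < c) :
    ∫⁻ y in D \ J c, k (x - y) * f y ∂μ ≤ M * 2 ^ κ * 2 *
      (∑' n : ℕ, ENNReal.ofReal (((2 : ℝ) ^ (n + 1)) ^ (-σ))) *
        (S * ENNReal.ofReal c ^ (-σ)) := by
  have hQ0 : 0 < Q := by linarith
  have hpos : ∀ n : ℕ, 0 < c * 2 ^ n := fun n => by positivity
  have hμV : ∀ n : ℕ, μ (J (c * 2 ^ n)) = ENNReal.ofReal (c * 2 ^ n) := fun n => hJ.measure_eq _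
  have hcov : D \ J c ⊆ ⋃ n : ℕ, J (c * 2 ^ (n + 1)) \ J (c * 2 ^ n) := fun y hy =>
    mem_iUnion.2 (hJ.exists_mem_sdiff_nat hc hy.1 hy.2)
  refine (lintegral_kernel_le_tsum μ (fun y => k (x - y)) f hf κ M (D \ J c)
    (fun n : ℕ => J (c * 2 ^ (n + 1))) (fun n : ℕ => J (c * 2 ^ n)) (fun _ => hJ.measurableSet _)
    (fun _ => hJ.measurableSet _) hcov.eventuallyLE (fun n => ?_) (fun n => ?_)
    (fun n y hy => ?_)).trans ?_
  · rw [hμV]; simpa using hc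
  · rw [hμV]; exact ENNReal.ofReal_ne_top
  · refine le_trans ?_ (hk x y)
    gcongr
    exact hJ.subset_uIcc _ y (hJ.subset _ hy.1) hy.2
  rw [← ENNReal.tsum_mul_left, ← ENNReal.tsum_mul_right]
  refine ENNReal.tsum_le_tsum fun n => ?_
  set R : ℝ := c * 2 ^ (n + 1) with hR
  have hR0 : 0 < R := by positivity
  have hRne : ENNReal.ofReal R ≠ 0 := by simpa using hR0
  have hRt : ENNReal.ofReal R ≠ ∞ := ENNReal.ofReal_ne_top
  have hV : μ (J (c * 2 ^ n)) ^ (-κ) = 2 ^ κ * ENNReal.ofReal R ^ (-κ) := by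
    have e : ENNReal.ofReal R = 2 * ENNReal.ofReal (c * 2 ^ n) := by
      rw [← ENNReal.ofReal_ofNat 2, ← ENNReal.ofReal_mul (by norm_num), hR]; congr 1; ring
    rw [hμV, e, ENNReal.mul_rpow_of_ne_top (by simp) ENNReal.ofReal_ne_top, ← mul_assoc,
      ← ENNReal.rpow_add _ _ (by simp) (by simp)]
    simp
  have hμU : μ (J R) = ENNReal.ofReal R := hJ.measure_eq _
  obtain ⟨l, u, -, -, hlu⟩ := hJ.eq_Ico R
  obtain ⟨i, hi⟩ := exists_setLIntegral_Ico_le_cell_add_cell μ hμ x₀ hR0 l u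
    (by rw [← hlu, hμU]) (fun y => f y ^ Q)
  rw [← hlu] at hi
  -- Two adjacent cells of scale `R` cover `J R` up to a null set, and Hölder contributes `R^(1 -
  -- 1/Q)`. The result `2 S R^(1 - d)` times the kernel factor `R^(-κ)` decays like `R^(-σ)`.
  have hU : ∫⁻ y in J R, f y ∂μ ≤
      2 * (S * ENNReal.ofReal R ^ (1 / Q - d)) * ENNReal.ofReal R ^ (1 - 1 / Q) := by
    refine (lintegral_le_rpow_mul_measure_rpow (μ.restrict (J R)) Q hQ f hf.restrict).trans ?_
    rw [Measure.restrict_apply_univ, hμU]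
    gcongr
    calc (∫⁻ y in J R, f y ^ Q ∂μ) ^ (1 / Q)
        ≤ (∫⁻ y in cell μ x₀ R i, f y ^ Q ∂μ + ∫⁻ y in cell μ x₀ R (i + 1), f y ^ Q ∂μ) ^
            (1 / Q) := by gcongr
      _ ≤ (∫⁻ y in cell μ x₀ R i, f y ^ Q ∂μ) ^ (1 / Q) +
            (∫⁻ y in cell μ x₀ R (i + 1), f y ^ Q ∂μ) ^ (1 / Q) :=
          ENNReal.rpow_add_le_add_rpow _ _ (by positivity)
            (by rw [div_le_one hQ0]; exact hQ)
      _ ≤ S * ENNReal.ofReal R ^ (1 / Q - d) + S * ENNReal.ofReal R ^ (1 / Q - d) :=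
          add_le_add (hS R hR0 i) (hS R hR0 (i + 1))
      _ = 2 * (S * ENNReal.ofReal R ^ (1 / Q - d)) := by ring
  calc M * μ (J (c * 2 ^ n)) ^ (-κ) * ∫⁻ y in J R, f y ∂μ
      ≤ M * (2 ^ κ * ENNReal.ofReal R ^ (-κ)) *
          (2 * (S * ENNReal.ofReal R ^ (1 / Q - d)) * ENNReal.ofReal R ^ (1 - 1 / Q)) := by
        rw [hV]; gcongr
    _ = M * 2 ^ κ * 2 * (S * (ENNReal.ofReal R ^ (-κ) * ENNReal.ofReal R ^ (1 / Q - d) *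
          ENNReal.ofReal R ^ (1 - 1 / Q))) := by ring
    _ = M * 2 ^ κ * 2 * (S * ENNReal.ofReal R ^ (-σ)) := by
        rw [← ENNReal.rpow_add _ _ hRne hRt, ← ENNReal.rpow_add _ _ hRne hRt]
        congr 3; rw [hσ]; ring
    _ = M * 2 ^ κ * 2 * ENNReal.ofReal ((2 ^ (n + 1)) ^ (-σ)) *
          (S * ENNReal.ofReal c ^ (-σ)) := by
        rw [hR, ENNReal.ofReal_mul hc.le, ENNReal.mul_rpow_of_ne_top ENNReal.ofReal_ne_top
          ENNReal.ofReal_ne_top, ENNReal.ofReal_rpow_of_pos (x := 2 ^ (n + 1)) (by positivity)]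
        ring

/-- The three cells around the `i`-th one. -/
noncomputable def tripleCell (μ : Measure ℝ) (x₀ r : ℝ) (i : ℤ) : Set ℝ :=
  Ico (cutPoint μ x₀ r (i - 1)) (cutPoint μ x₀ r (i + 2))

/-- Localization: if `Kf` is small away from the triple cells, the weak-type inequality on the
triple cells gives one in terms of the cell norms. -/
theorem weight_rpow_le_of_far_le (μ : Measure ℝ) [IsLocallyFiniteMeasure μ] [NullSingletonClass μ]
    (hμ : ∀ a : ℝ, μ (Iio a) = ∞ ∧ μ (Ici a) = ∞) (x₀ : ℝ) {θ P p : ℝ} (hP : 1 ≤ P)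
    (hp : 0 < p) (hpθ : p ≤ θ) (w : Measure ℝ) (v : ℝ → ℝ≥0) (k : ℝ → ℝ≥0∞) (C : ℝ≥0)
    (hwt : ∀ f : ℝ → ℝ≥0∞, AEMeasurable f μ → ∀ t : ℝ≥0, 0 < t →
      w {x | (t : ℝ≥0∞) < ∫⁻ y, k (x - y) * f y ∂μ} ^ (1 / θ) ≤
        C * ((t : ℝ≥0∞)⁻¹ * (∫⁻ y, (f y * v y) ^ P ∂μ) ^ (1 / P)))
    (f : ℝ → ℝ≥0∞) (hf : AEMeasurable f μ) (t : ℝ≥0) (ht : 0 < t) {r : ℝ} (hr : 0 < r)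
    (hfar : ∀ i, ∀ x ∈ cell μ x₀ r i,
      ∫⁻ y in (tripleCell μ x₀ r i)ᶜ, k (x - y) * f y ∂μ ≤ t / 2) :
    w {x | (t : ℝ≥0∞) < ∫⁻ y, k (x - y) * f y ∂μ} ^ (1 / θ) ≤
      C * 2 * 3 * 3 ^ (1 / θ) * ((t : ℝ≥0∞)⁻¹ *
        (∑' i : ℤ, ((∫⁻ y in cell μ x₀ r i, (f y * v y) ^ P ∂μ) ^ (1 / P)) ^ p) ^ (1 / p)) := by
  have hθ : 0 < θ := hp.trans_le hpθ
  have hP0 : 0 < P := by linarith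
  set F := {x | (t : ℝ≥0∞) < ∫⁻ y, k (x - y) * f y ∂μ} with hF
  set b : ℤ → ℝ≥0∞ := fun i => (∫⁻ y in cell μ x₀ r i, (f y * v y) ^ P ∂μ) ^ (1 / P) with hb
  have htriple : ∀ i, (∫⁻ y in tripleCell μ x₀ r i, (f y * v y) ^ P ∂μ) ^ (1 / P) ≤
      b (i - 1) + b i + b (i + 1) := by
    intro i
    have hsub : tripleCell μ x₀ r i ⊆
        (cell μ x₀ r (i - 1) ∪ cell μ x₀ r i) ∪ cell μ x₀ r (i + 1) := by
      intro y hy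
      have e : i - 1 + 1 = i := by ring
      have e' : i + 1 + 1 = i + 2 := by ring
      simp only [cell, e, e']
      rcases lt_or_ge y (cutPoint μ x₀ r i) with h1 | h1
      · exact Or.inl (Or.inl ⟨hy.1, h1⟩)
      rcases lt_or_ge y (cutPoint μ x₀ r (i + 1)) with h2 | h2
      · exact Or.inl (Or.inr ⟨h1, h2⟩)
      · exact Or.inr ⟨h2, hy.2⟩
    have h1P : 1 / P ≤ 1 := by rw [div_le_one hP0]; exact hP
    have hP1 : 0 ≤ 1 / P := by positivity
    calc (∫⁻ y in tripleCell μ x₀ r i, (f y * v y) ^ P ∂μ) ^ (1 / P)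
        ≤ (∫⁻ y in cell μ x₀ r (i - 1), (f y * v y) ^ P ∂μ +
            ∫⁻ y in cell μ x₀ r i, (f y * v y) ^ P ∂μ +
            ∫⁻ y in cell μ x₀ r (i + 1), (f y * v y) ^ P ∂μ) ^ (1 / P) := by
          gcongr
          exact (lintegral_mono_set hsub).trans ((lintegral_union_le _ _ _).trans
            (add_le_add (lintegral_union_le _ _ _) le_rfl))
      _ ≤ _ := (ENNReal.rpow_add_le_add_rpow _ _ hP1 h1P).trans
          (add_le_add (ENNReal.rpow_add_le_add_rpow _ _ hP1 h1P) le_rfl)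
  have hpiece : ∀ i, w (F ∩ cell μ x₀ r i) ≤
      (C * 2 * (t : ℝ≥0∞)⁻¹) ^ θ * (b (i - 1) + b i + b (i + 1)) ^ θ := by
    intro i
    have hmeas : MeasurableSet (tripleCell μ x₀ r i) := measurableSet_Ico
    set g := (tripleCell μ x₀ r i).indicator f with hg
    -- The far part takes at most `t/2`, so the potential of the truncated function must exceed
    -- `t/2`.
    have hsub : F ∩ cell μ x₀ r i ⊆
        {x | ((t / 2 : ℝ≥0) : ℝ≥0∞) < ∫⁻ y, k (x - y) * g y ∂μ} := by
      rintro x ⟨hx, hxi⟩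
      have hx' : (t : ℝ≥0∞) < ∫⁻ y, k (x - y) * f y ∂μ := hx
      have e : ∫⁻ y, k (x - y) * g y ∂μ = ∫⁻ y in tripleCell μ x₀ r i, k (x - y) * f y ∂μ := by
        rw [← lintegral_indicator hmeas]
        congr 1
        ext y
        by_cases hy : y ∈ tripleCell μ x₀ r i <;> simp [hg, hy]
      show ((t / 2 : ℝ≥0) : ℝ≥0∞) < ∫⁻ y, k (x - y) * g y ∂μ
      rw [e]
      by_contra hcon
      rw [not_lt] at hcon
      refine not_le_of_gt hx' ?_
      rw [← lintegral_add_compl _ hmeas]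
      calc _ ≤ ((t / 2 : ℝ≥0) : ℝ≥0∞) + t / 2 := add_le_add hcon (hfar i x hxi)
        _ = t := by
          rw [ENNReal.coe_div (by norm_num), ENNReal.coe_ofNat, ENNReal.add_halves]
    have h1 := hwt g (hf.indicator hmeas) (t / 2) (by positivity)
    have e2 : ∫⁻ y, (g y * v y) ^ P ∂μ = ∫⁻ y in tripleCell μ x₀ r i, (f y * v y) ^ P ∂μ := by
      rw [← lintegral_indicator hmeas]
      congr 1
      ext y
      by_cases hy : y ∈ tripleCell μ x₀ r i <;> simp [hg, hy, hP0]
    have e3 : ((t / 2 : ℝ≥0) : ℝ≥0∞)⁻¹ = 2 * (t : ℝ≥0∞)⁻¹ := by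
      rw [ENNReal.coe_div (by norm_num), ENNReal.coe_ofNat, ENNReal.inv_div (by simp) (by simp),
        div_eq_mul_inv]
    rw [e2, e3] at h1
    rw [← ENNReal.mul_rpow_of_nonneg _ _ hθ.le]
    calc w (F ∩ cell μ x₀ r i)
        = (w (F ∩ cell μ x₀ r i) ^ (1 / θ)) ^ θ := by
          rw [← ENNReal.rpow_mul, one_div_mul_cancel hθ.ne', ENNReal.rpow_one]
      _ ≤ _ := by
          refine ENNReal.rpow_le_rpow ?_ hθ.le
          calc w (F ∩ cell μ x₀ r i) ^ (1 / θ)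
              ≤ w {x | ((t / 2 : ℝ≥0) : ℝ≥0∞) < ∫⁻ y, k (x - y) * g y ∂μ} ^ (1 / θ) := by
                gcongr
            _ ≤ C * (2 * (t : ℝ≥0∞)⁻¹ *
                  (∫⁻ y in tripleCell μ x₀ r i, (f y * v y) ^ P ∂μ) ^ (1 / P)) := h1
            _ ≤ C * (2 * (t : ℝ≥0∞)⁻¹ * (b (i - 1) + b i + b (i + 1))) := by
                gcongr
                exact htriple i
            _ = _ := by ring
  have hFle : w F ≤ (C * 2 * (t : ℝ≥0∞)⁻¹) ^ θ * (3 ^ θ * 3 * ∑' i : ℤ, b i ^ θ) := by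
    have hcov : F ⊆ ⋃ i, F ∩ cell μ x₀ r i := fun x hx => by
      obtain ⟨i, hi⟩ := exists_mem_cell μ hμ x₀ hr x
      exact mem_iUnion.2 ⟨i, hx, hi⟩
    calc w F ≤ ∑' i, w (F ∩ cell μ x₀ r i) := (measure_mono hcov).trans (measure_iUnion_le _)
      _ ≤ ∑' i, (C * 2 * (t : ℝ≥0∞)⁻¹) ^ θ * (b (i - 1) + b i + b (i + 1)) ^ θ :=
          ENNReal.tsum_le_tsum hpiece
      _ ≤ _ := by
          rw [ENNReal.tsum_mul_left]
          gcongr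
          exact tsum_rpow_add_neighbours_le b hθ.le
  have hroot : ∀ z : ℝ≥0∞, (z ^ θ) ^ (1 / θ) = z := fun z => by
    rw [← ENNReal.rpow_mul, mul_one_div_cancel hθ.ne', ENNReal.rpow_one]
  have h1θ : 0 ≤ 1 / θ := by positivity
  calc w F ^ (1 / θ)
      ≤ ((C * 2 * (t : ℝ≥0∞)⁻¹) ^ θ * (3 ^ θ * 3 * ∑' i : ℤ, b i ^ θ)) ^ (1 / θ) := by gcongr
    _ = C * 2 * 3 * 3 ^ (1 / θ) * ((t : ℝ≥0∞)⁻¹ * (∑' i : ℤ, b i ^ θ) ^ (1 / θ)) := by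
        rw [ENNReal.mul_rpow_of_nonneg _ _ h1θ, ENNReal.mul_rpow_of_nonneg _ _ h1θ,
          ENNReal.mul_rpow_of_nonneg _ _ h1θ, hroot, hroot]
        ring
    _ ≤ _ := by
        gcongr
        exact tsum_rpow_rpow_inv_anti b hp hpθ

/-- The scale `r` is free in the localized inequality. It is taken as a multiple of `(S/t)^(1/σ)`,
just large enough to make the far part at most `t/2`; the growth `T r^e` of the cell norms then
becomes `T (S/t)^(e/σ)` up to a constant. -/
theorem exists_amalgam_weak_type (μ : Measure ℝ) [IsLocallyFiniteMeasure μ] [NullSingletonClass μ]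
    (hμ : ∀ a : ℝ, μ (Iio a) = ∞ ∧ μ (Ici a) = ∞) (x₀ : ℝ) {θ κ σ P Q p d e : ℝ} (hκ : 0 < κ)
    (hσ0 : 0 < σ) (hσ : σ = κ - 1 + d) (hQ : 1 ≤ Q) (hP : 1 ≤ P) (hp : 0 < p) (hpθ : p ≤ θ)
    (w : Measure ℝ) (v : ℝ → ℝ≥0) (k : ℝ → ℝ≥0∞) (M : ℝ≥0∞) (hM : M ≠ ∞)
    (hk : ∀ x y, k (x - y) * μ (uIcc x y) ^ κ ≤ M) (C : ℝ≥0)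
    (hwt : ∀ f : ℝ → ℝ≥0∞, AEMeasurable f μ → ∀ t : ℝ≥0, 0 < t →
      w {x | (t : ℝ≥0∞) < ∫⁻ y, k (x - y) * f y ∂μ} ^ (1 / θ) ≤
        C * ((t : ℝ≥0∞)⁻¹ * (∫⁻ y, (f y * v y) ^ P ∂μ) ^ (1 / P))) :
    ∃ C' : ℝ≥0, 0 < C' ∧ ∀ f : ℝ → ℝ≥0∞, AEMeasurable f μ → ∀ t : ℝ≥0, 0 < t →
      ∀ (S : ℝ≥0) (T : ℝ≥0∞), 0 < S →
      (∀ r : ℝ, 0 < r → ∀ i : ℤ, (∫⁻ y in cell μ x₀ r i, f y ^ Q ∂μ) ^ (1 / Q) ≤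
        S * ENNReal.ofReal r ^ (1 / Q - d)) →
      (∀ r : ℝ, 0 < r →
        (∑' i : ℤ, ((∫⁻ y in cell μ x₀ r i, (f y * v y) ^ P ∂μ) ^ (1 / P)) ^ p) ^ (1 / p) ≤
          T * ENNReal.ofReal r ^ e) →
      w {x | (t : ℝ≥0∞) < ∫⁻ y, k (x - y) * f y ∂μ} ^ (1 / θ) ≤
        C' * ((t : ℝ≥0∞)⁻¹ * T) * ((t : ℝ≥0∞)⁻¹ * S) ^ (e / σ) := by
  set A : ℝ≥0∞ := M * 2 ^ κ * 2 *
      (∑' n : ℕ, ENNReal.ofReal (((2 : ℝ) ^ (n + 1)) ^ (-σ))) * 2 ^ σ with hA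
  have hAt : A ≠ ∞ := by
    refine ENNReal.mul_ne_top (ENNReal.mul_ne_top (ENNReal.mul_ne_top (ENNReal.mul_ne_top hM
      (ENNReal.rpow_ne_top_of_nonneg hκ.le (by simp))) (by simp))
      (tsum_two_pow_rpow_neg_ne_top hσ0)) (ENNReal.rpow_ne_top_of_nonneg hσ0.le (by simp))
  obtain ⟨A', hA'⟩ : ∃ A' : ℝ≥0, (A' : ℝ≥0∞) = A := ⟨_, ENNReal.coe_toNNReal hAt⟩
  set L : ℝ≥0 := 4 * A' + 1 with hL
  have hL0 : 0 < L := by positivity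
  have hLne : (L : ℝ≥0∞) ≠ 0 := by exact_mod_cast hL0.ne'
  refine ⟨(C + 1) * 2 * 3 * 3 ^ (1 / θ) * L ^ (e / σ), by positivity,
    fun f hf t ht S T hS0 hS hT => ?_⟩
  have htne : (t : ℝ≥0∞) ≠ 0 := by exact_mod_cast ht.ne'
  have hSne : (S : ℝ≥0∞) ≠ 0 := by exact_mod_cast hS0.ne'
  -- With `r^σ = ρ = L S / t`, the far integral on one side is at most `A t / L`. The factor `2 ^ σ`
  -- in `A` pays for using the distance `r / 2`, and `L = 4 A' + 1` makes the bound at most `t/4`.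
  set ρ : ℝ≥0 := L * (t⁻¹ * S) with hρ
  have hρ0 : 0 < ρ := by positivity
  set r : ℝ≥0 := ρ ^ (1 / σ) with hr
  have hr0 : 0 < r := by positivity
  have hr0' : (0 : ℝ) < r := by exact_mod_cast hr0
  have hrpow : ∀ z : ℝ, ENNReal.ofReal (r : ℝ) ^ z =
      (L : ℝ≥0∞) ^ (z / σ) * ((t : ℝ≥0∞)⁻¹ * S) ^ (z / σ) := fun z => by
    rw [ENNReal.ofReal_coe_nnreal, hr, ENNReal.coe_rpow_of_ne_zero hρ0.ne', ← ENNReal.rpow_mul,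
      one_div_mul_eq_div, hρ, ENNReal.coe_mul, ENNReal.coe_mul, ENNReal.coe_inv ht.ne',
      ENNReal.mul_rpow_of_ne_top ENNReal.coe_ne_top
        (ENNReal.mul_ne_top (by simpa using ht.ne') ENNReal.coe_ne_top)]
  have hside : ∀ x D J, OneSidedFamily μ x D J →
      ∫⁻ y in D \ J (r / 2), k (x - y) * f y ∂μ ≤ t / 4 := by
    intro x D J hJ
    refine (lintegral_kernel_far_le μ hμ x₀ hQ hσ k M hk hκ f hf S hS x D J hJ (r / 2)
      (by positivity)).trans ?_
    have e1 : ENNReal.ofReal ((r : ℝ) / 2) ^ (-σ) = 2 ^ σ * ENNReal.ofReal (r : ℝ) ^ (-σ) := by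
      have : ENNReal.ofReal (r : ℝ) = 2 * ENNReal.ofReal ((r : ℝ) / 2) := by
        rw [← ENNReal.ofReal_ofNat 2, ← ENNReal.ofReal_mul (by norm_num)]; congr 1; ring
      rw [this, ENNReal.mul_rpow_of_ne_top (by simp) ENNReal.ofReal_ne_top, ← mul_assoc,
        ← ENNReal.rpow_add _ _ (by simp) (by simp)]
      simp
    have e2 : ENNReal.ofReal (r : ℝ) ^ (-σ) = (L : ℝ≥0∞)⁻¹ * (t * (S : ℝ≥0∞)⁻¹) := by
      rw [hrpow, neg_div, div_self hσ0.ne', ENNReal.rpow_neg_one, ENNReal.rpow_neg_one,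
        ENNReal.mul_inv (Or.inl (by simp)) (Or.inl (by simpa using ht.ne')), inv_inv]
    rw [e1, e2]
    calc _ = A * ((L : ℝ≥0∞)⁻¹ * t) * (S * (S : ℝ≥0∞)⁻¹) := by rw [hA]; ring
      _ = A * ((L : ℝ≥0∞)⁻¹ * t) := by
          rw [ENNReal.mul_inv_cancel hSne ENNReal.coe_ne_top, mul_one]
      _ = (4 * A) * ((L : ℝ≥0∞)⁻¹ * t) / 4 := by
          rw [mul_assoc 4, mul_comm 4, ENNReal.mul_div_cancel_right (by simp) (by simp)]
      _ ≤ L * ((L : ℝ≥0∞)⁻¹ * t) / 4 := by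
          gcongr
          rw [← hA', hL]
          push_cast
          exact le_self_add
      _ = t / 4 := by
          rw [← mul_assoc, ENNReal.mul_inv_cancel hLne ENNReal.coe_ne_top, one_mul]
  have hhalf : ENNReal.ofReal ((r : ℝ) / 2) < ENNReal.ofReal r :=
    (ENNReal.ofReal_lt_ofReal_iff hr0').2 (by linarith)
  have hmono := (cutPoint_strictMono μ hμ x₀ hr0').monotone
  have hfar : ∀ i, ∀ x ∈ cell μ x₀ r i,
      ∫⁻ y in (tripleCell μ x₀ r i)ᶜ, k (x - y) * f y ∂μ ≤ t / 2 := by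
    intro i x hx
    obtain ⟨J, hJ⟩ := exists_oneSidedFamily_Ici μ x (hμ x).2
    obtain ⟨J', hJ'⟩ := exists_oneSidedFamily_Iio μ x (hμ x).1
    -- A point outside the triple is separated from `x` by a whole cell of measure `r`. Using `r /
    -- 2` instead of `r` supplies the strict inequality required by `notMem_of_lt_measure_uIcc`.
    have hsub : (tripleCell μ x₀ r i)ᶜ ⊆ (Ici x \ J (r / 2)) ∪ (Iio x \ J' (r / 2)) := by
      intro y hy
      have hxl : cutPoint μ x₀ r i ≤ x := hx.1
      have hxu : x < cutPoint μ x₀ r (i + 1) := hx.2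
      rcases lt_or_ge y (cutPoint μ x₀ r (i - 1)) with h1 | h1
      · have hyx : y < x := (h1.trans_le (hmono (by omega))).trans_le hxl
        refine Or.inr ⟨hyx, hJ'.notMem_of_lt_measure_uIcc (hhalf.trans_le ?_)⟩
        rw [← measure_cell μ hμ x₀ r hr0' (i - 1), uIcc_of_ge hyx.le]
        refine measure_mono fun z hz => ⟨h1.le.trans hz.1, hz.2.le.trans ?_⟩
        rwa [sub_add_cancel]
      · have h2 : cutPoint μ x₀ r (i + 2) ≤ y := not_lt.1 fun h => hy ⟨h1, h⟩
        have hxy : x ≤ y := hxu.le.trans ((hmono (by omega)).trans h2)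
        refine Or.inl ⟨hxy, hJ.notMem_of_lt_measure_uIcc (hhalf.trans_le ?_)⟩
        rw [← measure_cell μ hμ x₀ r hr0' (i + 1), uIcc_of_le hxy]
        refine measure_mono fun z hz => ⟨hxu.le.trans hz.1, hz.2.le.trans ?_⟩
        rwa [add_assoc]
    calc _ ≤ ∫⁻ y in (Ici x \ J (r / 2)) ∪ (Iio x \ J' (r / 2)), k (x - y) * f y ∂μ :=
          lintegral_mono_set hsub
      _ ≤ t / 4 + t / 4 :=
          (lintegral_union_le _ _ _).trans (add_le_add (hside x _ J hJ) (hside x _ J' hJ'))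
      _ = t / 2 := by
          have : (t : ℝ≥0∞) / 4 = t / 2 / 2 := by
            rw [div_eq_mul_inv, div_eq_mul_inv, div_eq_mul_inv, mul_assoc,
              ← ENNReal.mul_inv (by simp) (by simp)]
            norm_num
          rw [this, ENNReal.add_halves]
  refine (weight_rpow_le_of_far_le μ hμ x₀ hP hp hpθ w v k C hwt f hf t ht hr0' hfar).trans ?_
  calc _ ≤ ((C + 1 : ℝ≥0) : ℝ≥0∞) * 2 * 3 * 3 ^ (1 / θ) *
        ((t : ℝ≥0∞)⁻¹ * (T * ENNReal.ofReal (r : ℝ) ^ e)) := by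
        gcongr
        · exact le_self_add
        · exact hT r hr0'
    _ = _ := by
        rw [hrpow, ENNReal.coe_mul, ENNReal.coe_mul, ENNReal.coe_rpow_of_ne_zero hL0.ne',
          ENNReal.coe_mul, ENNReal.coe_mul, ENNReal.coe_rpow_of_ne_zero (by norm_num)]
        push_cast
        ring

/-! ### Passage from cell integrals to the norms `‖·‖_{q,p,α}` -/

theorem eLpNorm_nnreal_eq_lintegral {Ω : Type*} [MeasurableSpace Ω] (m : Measure Ω) {q : ℝ≥0∞}
    (hq0 : q ≠ 0) (hqt : q ≠ ∞) (f : Ω → ℝ≥0) :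
    eLpNorm f q m = (∫⁻ x, (f x : ℝ≥0∞) ^ q.toReal ∂m) ^ (1 / q.toReal) :=
  eLpNorm_eq_lintegral_rpow_enorm_toReal hq0 hqt

theorem stepNorm_le_fracNorm_mul (μ : Measure ℝ) (x₀ : ℝ) (q p α : ℝ≥0∞) (f : ℝ → ℝ≥0) (r : ℝ)
    (hr : 0 < r) :
    stepNorm μ x₀ r q p f ≤
      fracNorm μ x₀ q p α f * ENNReal.ofReal r ^ ((q⁻¹).toReal - (α⁻¹).toReal) := by
  have hr0 : ENNReal.ofReal r ≠ 0 := by simpa using hr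
  have h : ENNReal.ofReal r ^ ((α⁻¹).toReal - (q⁻¹).toReal) * stepNorm μ x₀ r q p f ≤
      fracNorm μ x₀ q p α f :=
    le_iSup₂_of_le (f := fun (r : ℝ) (_ : 0 < r) =>
      ENNReal.ofReal r ^ ((α⁻¹).toReal - (q⁻¹).toReal) * stepNorm μ x₀ r q p f) r hr le_rfl
  calc stepNorm μ x₀ r q p f
      = ENNReal.ofReal r ^ ((α⁻¹).toReal - (q⁻¹).toReal) * stepNorm μ x₀ r q p f *
          ENNReal.ofReal r ^ ((q⁻¹).toReal - (α⁻¹).toReal) := by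
        rw [mul_right_comm, ← ENNReal.rpow_add _ _ hr0 ENNReal.ofReal_ne_top]; simp
    _ ≤ _ := by gcongr

/-- A bound for the integrals over all cells of all scales gives a bound for the whole integral. -/
theorem lintegral_le_two_mul_of_forall_cell_le (μ : Measure ℝ) [IsLocallyFiniteMeasure μ]
    [NullSingletonClass μ] (hμ : ∀ a : ℝ, μ (Iio a) = ∞ ∧ μ (Ici a) = ∞) (x₀ : ℝ) (g : ℝ → ℝ≥0∞)
    (B : ℝ≥0∞) (h : ∀ r : ℝ, 0 < r → ∀ i, ∫⁻ y in cell μ x₀ r i, g y ∂μ ≤ B) :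
    ∫⁻ y, g y ∂μ ≤ 2 * B := by
  have hmono : Monotone fun n : ℕ => Ico (-(n : ℝ)) n := fun m n hmn => by
    have : (m : ℝ) ≤ n := by exact_mod_cast hmn
    exact Ico_subset_Ico (by linarith) this
  have happ : ∀ s, μ.withDensity g s = ∫⁻ y in s, g y ∂μ := fun s => withDensity_apply' _ _
  have hlim := tendsto_measure_iUnion_atTop (μ := μ.withDensity g) hmono
  rw [iUnion_Ico_neg_natCast, happ, Measure.restrict_univ] at hlim
  refine le_of_tendsto' hlim fun n => ?_
  -- At a scale exceeding the measure of `[-n, n)`, two cells cover that interval up to a null set.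
  have hr : 0 < (μ (Ico (-(n : ℝ)) n)).toReal + 1 := by positivity
  obtain ⟨i, hi⟩ := exists_setLIntegral_Ico_le_cell_add_cell μ hμ x₀ hr (-(n : ℝ)) n
    (by
      rw [ENNReal.le_ofReal_iff_toReal_le measure_Ico_lt_top.ne hr.le]
      linarith) g
  calc _ = ∫⁻ y in Ico (-(n : ℝ)) n, g y ∂μ := happ _
    _ ≤ B + B := hi.trans (add_le_add (h _ hr _) (h _ hr _))
    _ = 2 * B := (two_mul B).symm

/-- The weak-type inequality in the norms `‖·‖_{q,p,α}`. -/
theorem exists_fracNorm_weak_type (μ : Measure ℝ) [IsLocallyFiniteMeasure μ]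
    [NullSingletonClass μ] (hμ : ∀ a : ℝ, μ (Iio a) = ∞ ∧ μ (Ici a) = ∞) (x₀ : ℝ) {θ κ s : ℝ}
    {q α q₁ α₁ p₁ : ℝ≥0∞} (hκ : 0 < κ) (hs : 0 < s) (hsκ : s⁻¹ = κ - 1 + (α⁻¹).toReal)
    (hq : 1 ≤ q) (hqt : q ≠ ∞) (hq₁ : 1 ≤ q₁) (hq₁t : q₁ ≠ ∞) (hq₁α₁ : q₁ ≤ α₁)
    (hp₁ : 1 ≤ p₁) (hp₁t : p₁ ≠ ∞) (hp₁θ : p₁.toReal ≤ θ)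
    (w : Measure ℝ) (v : ℝ → ℝ≥0) (k : ℝ → ℝ≥0∞) (M : ℝ≥0∞) (hM : M ≠ ∞)
    (hk : ∀ x y, k (x - y) * μ (uIcc x y) ^ κ ≤ M) (C : ℝ≥0)
    (hwt : ∀ f : ℝ → ℝ≥0∞, AEMeasurable f μ → ∀ t : ℝ≥0, 0 < t →
      w {x | (t : ℝ≥0∞) < ∫⁻ y, k (x - y) * f y ∂μ} ^ (1 / θ) ≤
        C * ((t : ℝ≥0∞)⁻¹ * (∫⁻ y, (f y * v y) ^ q₁.toReal ∂μ) ^ (1 / q₁.toReal))) :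
    ∃ C' : ℝ≥0, ∀ f : ℝ → ℝ≥0, AEMeasurable f μ → ∀ t : ℝ≥0, 0 < t →
      w {x | (t : ℝ≥0∞) < potential μ k f x} ^ (1 / θ) ≤
        C' * ((t : ℝ≥0∞)⁻¹ * fracNorm μ x₀ q₁ p₁ α₁ (fun x => f x * v x)) *
          ((t : ℝ≥0∞)⁻¹ * fracNorm μ x₀ q ∞ α f) ^ (s * ((q₁⁻¹).toReal - (α₁⁻¹).toReal)) := by
  have toReal_one_le : ∀ {a : ℝ≥0∞}, 1 ≤ a → a ≠ ∞ → 1 ≤ a.toReal := fun h1 ht => by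
    simpa using ENNReal.toReal_mono ht h1
  have hQ := toReal_one_le hq hqt
  have hP := toReal_one_le hq₁ hq₁t
  have hp := toReal_one_le hp₁ hp₁t
  set Q := q.toReal with hQdef
  set P := q₁.toReal with hPdef
  set p := p₁.toReal with hpdef
  have hQ0 : 0 < Q := by linarith
  have hP0 : 0 < P := by linarith
  have hp0 : 0 < p := by linarith
  have hq0 : q ≠ 0 := (one_pos.trans_le hq).ne'
  have hq₁0 : q₁ ≠ 0 := (one_pos.trans_le hq₁).ne'
  set e := (q₁⁻¹).toReal - (α₁⁻¹).toReal with he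
  have he0 : 0 ≤ e :=
    sub_nonneg.2 (ENNReal.toReal_mono (by simpa using hq₁0) (ENNReal.inv_le_inv.2 hq₁α₁))
  obtain ⟨C₂, hC₂, hmain⟩ := exists_amalgam_weak_type μ hμ x₀ (Q := Q) (e := e) hκ (inv_pos.2 hs)
    hsκ hQ hP hp0 hp₁θ w v k M hM hk C hwt
  refine ⟨2 * C + C₂, fun f hf t ht => ?_⟩
  set S := fracNorm μ x₀ q ∞ α f with hS
  set T := fracNorm μ x₀ q₁ p₁ α₁ (fun x => f x * v x) with hT
  have htinv : (t : ℝ≥0∞)⁻¹ ≠ 0 := by simp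
  have htinv' : (t : ℝ≥0∞)⁻¹ ≠ ∞ := by simpa using ht.ne'
  have hC0 : ((2 * C + C₂ : ℝ≥0) : ℝ≥0∞) ≠ 0 := by
    exact_mod_cast (by positivity : (0 : ℝ≥0) < 2 * C + C₂).ne'
  have hScell : ∀ r : ℝ, 0 < r → ∀ i : ℤ, (∫⁻ y in cell μ x₀ r i, (f y : ℝ≥0∞) ^ Q ∂μ) ^ (1 / Q) ≤
      S * ENNReal.ofReal r ^ (1 / Q - (α⁻¹).toReal) := fun r hr i => by
    have h := stepNorm_le_fracNorm_mul μ x₀ q ∞ α f r hr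
    rw [stepNorm, if_pos rfl, ← hS, ENNReal.toReal_inv, ← hQdef, ← one_div] at h
    rw [← eLpNorm_nnreal_eq_lintegral (μ.restrict (cell μ x₀ r i)) hq0 hqt f]
    exact (le_iSup (fun i => eLpNorm f q (μ.restrict (cell μ x₀ r i))) i).trans h
  have hTcell : ∀ r : ℝ, 0 < r →
      (∑' i : ℤ, ((∫⁻ y in cell μ x₀ r i, ((f y : ℝ≥0∞) * v y) ^ P ∂μ) ^ (1 / P)) ^ p) ^ (1 / p) ≤
        T * ENNReal.ofReal r ^ e := fun r hr => by
    have h := stepNorm_le_fracNorm_mul μ x₀ q₁ p₁ α₁ (fun x => f x * v x) r hr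
    rw [stepNorm, if_neg hp₁t] at h
    simpa only [eLpNorm_nnreal_eq_lintegral _ hq₁0 hq₁t, ENNReal.coe_mul] using h
  have hTcell' : ∀ r : ℝ, 0 < r → ∀ i : ℤ,
      ∫⁻ y in cell μ x₀ r i, ((f y : ℝ≥0∞) * v y) ^ P ∂μ ≤ (T * ENNReal.ofReal r ^ e) ^ P := by
    intro r hr i
    have h1 : ((∫⁻ y in cell μ x₀ r i, ((f y : ℝ≥0∞) * v y) ^ P ∂μ) ^ (1 / P)) ^ p ≤
        (T * ENNReal.ofReal r ^ e) ^ p := by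
      have h2 := ENNReal.rpow_le_rpow (hTcell r hr) hp0.le
      rw [← ENNReal.rpow_mul, one_div_mul_cancel hp0.ne', ENNReal.rpow_one] at h2
      exact (ENNReal.le_tsum i).trans h2
    rw [ENNReal.rpow_le_rpow_iff hp0] at h1
    have h3 := ENNReal.rpow_le_rpow h1 hP0.le
    rwa [← ENNReal.rpow_mul, one_div_mul_cancel hP0.ne', ENNReal.rpow_one] at h3
  have hfm : AEMeasurable (fun y => (f y : ℝ≥0∞)) μ := hf.coe_nnreal_ennreal
  have hweak := hwt _ hfm t ht
  change w {x | (t : ℝ≥0∞) < potential μ k f x} ^ (1 / θ) ≤ _ at hweak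
  have hzero : ∫⁻ y, ((f y : ℝ≥0∞) * v y) ^ P ∂μ = 0 →
      w {x | (t : ℝ≥0∞) < potential μ k f x} ^ (1 / θ) ≤
        ((2 * C + C₂ : ℝ≥0) : ℝ≥0∞) * ((t : ℝ≥0∞)⁻¹ * T) * ((t : ℝ≥0∞)⁻¹ * S) ^ (s * e) := by
    intro h0
    rw [h0, ENNReal.zero_rpow_of_pos (by positivity), mul_zero, mul_zero] at hweak
    exact hweak.trans zero_le
  -- For `e = 0` the last factor is 1 even when `S` is 0 or infinite, so it gives no help. The cell
  -- bounds are then uniform in `r`, the whole `L^P` norm of `f v` is at most `2 T`, and the first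
  -- inequality suffices.
  rcases he0.eq_or_lt with he' | he'
  · rw [← he', mul_zero, ENNReal.rpow_zero, mul_one]
    have h1 : ∫⁻ y, ((f y : ℝ≥0∞) * v y) ^ P ∂μ ≤ 2 * T ^ P :=
      lintegral_le_two_mul_of_forall_cell_le μ hμ x₀ _ _ fun r hr i => by
        simpa [← he'] using hTcell' r hr i
    have h2 : (∫⁻ y, ((f y : ℝ≥0∞) * v y) ^ P ∂μ) ^ (1 / P) ≤ 2 * T := by
      calc _ ≤ (2 ^ P * T ^ P) ^ (1 / P) := by
            gcongr
            refine h1.trans ?_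
            gcongr
            conv_lhs => rw [← ENNReal.rpow_one 2]
            exact ENNReal.rpow_le_rpow_of_exponent_le (by norm_num) hP
        _ = 2 * T := by
            rw [← ENNReal.mul_rpow_of_nonneg _ _ hP0.le, ← ENNReal.rpow_mul,
              mul_one_div_cancel hP0.ne', ENNReal.rpow_one]
    calc _ ≤ _ := hweak
      _ ≤ C * ((t : ℝ≥0∞)⁻¹ * (2 * T)) := by gcongr
      _ = ((2 * C : ℝ≥0) : ℝ≥0∞) * ((t : ℝ≥0∞)⁻¹ * T) := by push_cast; ring
      _ ≤ _ := by
          gcongr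
          exact le_self_add
  have hse : 0 < s * e := by positivity
  rcases eq_or_ne S 0 with hS0 | hS0
  · refine hzero ?_
    have h0 : ∫⁻ y, (f y : ℝ≥0∞) ^ Q ∂μ = 0 := by
      have := lintegral_le_two_mul_of_forall_cell_le μ hμ x₀ (fun y => (f y : ℝ≥0∞) ^ Q) 0
        fun r hr i => by
          have h := hScell r hr i
          rw [hS0, zero_mul, nonpos_iff_eq_zero,
            ENNReal.rpow_eq_zero_iff_of_pos (by positivity)] at h
          exact h.le
      simpa using this
    rw [lintegral_eq_zero_iff' (hfm.pow_const Q)] at h0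
    rw [lintegral_congr_ae (g := fun _ => 0) ?_, lintegral_zero]
    filter_upwards [h0] with y hy
    rw [Pi.zero_apply, ENNReal.rpow_eq_zero_iff_of_pos hQ0] at hy
    rw [hy, zero_mul, ENNReal.zero_rpow_of_pos hP0]
  rcases eq_or_ne S ∞ with hSt | hSt
  -- For `S = ∞` the right-hand side is infinite unless `T = 0`, because `e > 0` and the constant is
  -- positive. If `T = 0`, then `f v` vanishes almost everywhere.
  · rcases eq_or_ne T 0 with hT0 | hT0
    · refine hzero ?_
      have := lintegral_le_two_mul_of_forall_cell_le μ hμ x₀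
        (fun y => ((f y : ℝ≥0∞) * v y) ^ P) 0 fun r hr i => by
          simpa [hT0, hP0] using hTcell' r hr i
      simpa using this
    · rw [hSt, ENNReal.mul_top htinv, ENNReal.top_rpow_of_pos hse, ENNReal.mul_top
        (mul_ne_zero hC0 (mul_ne_zero htinv hT0))]
      exact le_top
  obtain ⟨S', hS'⟩ : ∃ S' : ℝ≥0, (S' : ℝ≥0∞) = S := ⟨_, ENNReal.coe_toNNReal hSt⟩
  have hS'0 : 0 < S' := pos_iff_ne_zero.2 fun h0 => hS0 (by rw [← hS', h0, ENNReal.coe_zero])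
  rw [← hS'] at hScell
  have h := hmain _ hfm t ht S' T hS'0 hScell hTcell
  rw [hS', div_inv_eq_mul, mul_comm e s] at h
  refine h.trans ?_
  gcongr
  exact le_add_self

end Amalgam

/-! ### The main theorem -/

theorem mainTheorem3
    (μ : Measure ℝ) [IsLocallyFiniteMeasure μ] [NullSingletonClass μ]
    (hμ : ∀ a : ℝ, μ (Iio a) = ∞ ∧ μ (Ici a) = ∞)
    (x₀ : ℝ)
    (q α β q₁ α₁ p₁ : ℝ≥0∞)
    (hq : 1 ≤ q) (hqα : q ≤ α) (hαβ : α ≤ β) (hβ : β ≠ ∞)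
    (hqq₁ : q ≤ q₁) (hq₁α₁ : q₁ ≤ α₁) (hα₁p₁ : α₁ ≤ p₁)
    (θ η : ℝ)
    (hθ : θ⁻¹ = (q₁⁻¹).toReal - (β⁻¹).toReal) (hθ_pos : 0 < θ⁻¹)
    (hη : η⁻¹ = 1 - (β⁻¹).toReal)
    (C₃ : ℝ≥0)
    (hright : limsup (fun r : ℝ => ⨆ t : ℝ, μ (Icc t (t + r)) / μ (Icc 0 r)) atTop ≤ C₃)
    (hleft : limsup (fun r : ℝ => ⨆ t : ℝ, μ (Icc (t - r) t) / μ (Icc (-r) 0)) atTop ≤ C₃)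
    (k : ℝ → ℝ≥0∞)
    (hk_even : ∀ x, k (-x) = k x) (hk_anti : AntitoneOn k (Ioi 0))
    (hk_lsc : LowerSemicontinuous k)
    (hk_weak : (⨆ x : ℝ, Amalgam.weakNorm μ η (fun y => k (x - y))) < ∞)
    (hk_weak' : (⨆ y : ℝ, Amalgam.weakNorm μ η (fun x => k (x - y))) < ∞)
    (v : ℝ → ℝ≥0) (hv : AEMeasurable v μ)
    (C₄ : ℝ≥0) (hvC : Amalgam.WeightCondition μ θ q q₁ v C₄) :
    ∃ C : ℝ≥0, ∀ f : ℝ → ℝ≥0, AEMeasurable f μ → ∀ t : ℝ≥0, 0 < t →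
      (∫⁻ x in {x | (t : ℝ≥0∞) < Amalgam.potential μ k f x}, (v x : ℝ≥0∞) ^ θ ∂μ) ^ (1 / θ)
          ≤ C * ((t : ℝ≥0∞)⁻¹ * eLpNorm (fun x => f x * v x) q₁ μ) ∧
      (α < β → θ⁻¹ ≤ (p₁⁻¹).toReal → ∀ s : ℝ, s⁻¹ = (α⁻¹).toReal - (β⁻¹).toReal →
        (∫⁻ x in {x | (t : ℝ≥0∞) < Amalgam.potential μ k f x}, (v x : ℝ≥0∞) ^ θ ∂μ) ^ (1 / θ)
          ≤ C * ((t : ℝ≥0∞)⁻¹ * Amalgam.fracNorm μ x₀ q₁ p₁ α₁ (fun x => f x * v x)) *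
              ((t : ℝ≥0∞)⁻¹ * Amalgam.fracNorm μ x₀ q ∞ α f) ^
                (s * ((q₁⁻¹).toReal - (α₁⁻¹).toReal))) := by
  have hαt : α ≠ ∞ := ne_top_of_le_ne_top hβ hαβ
  have hqt : q ≠ ∞ := ne_top_of_le_ne_top hαt hqα
  have hq₁1 : 1 ≤ q₁ := hq.trans hqq₁
  have hq₁0 : q₁ ≠ 0 := (one_pos.trans_le hq₁1).ne'
  have hq₁t : q₁ ≠ ∞ := by
    rintro rfl
    have : 0 ≤ (β⁻¹).toReal := ENNReal.toReal_nonneg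
    simp only [ENNReal.inv_top, ENNReal.toReal_zero] at hθ
    linarith
  have hP : 1 ≤ q₁.toReal := by simpa using ENNReal.toReal_mono hq₁t hq₁1
  have hP0 : 0 < q₁.toReal := by linarith
  have hB0 : 0 < (β⁻¹).toReal :=
    ENNReal.toReal_pos (by simpa using hβ)
      (by simpa using (one_pos.trans_le (hq.trans (hqα.trans hαβ))).ne')
  rw [ENNReal.toReal_inv q₁] at hθ
  have hθ0 : 0 < θ := inv_pos.1 hθ_pos
  -- Finiteness of `β` makes `1/β` positive, hence `1/θ < 1/q₁` strictly.
  have hPθ : q₁.toReal < θ := by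
    rw [← inv_lt_inv₀ hθ0 hP0]; linarith
  have hP1 : q₁.toReal⁻¹ ≤ 1 := inv_le_one_of_one_le₀ hP
  have hη0 : 0 < η := inv_pos.1 (by linarith)
  -- Both sides equal `1 - 1/β`: the decay exponent of the kernel is exactly the one in the average
  -- bound.
  have hκP : 1 / η = 1 / θ + 1 - 1 / q₁.toReal := by
    simp only [one_div]; linarith
  have hκ : 0 < 1 / η := by positivity
  have hk := Amalgam.kernel_mul_measure_uIcc_le μ η hη0 k hk_even hk_anti
  have hAB := hvC.averageBound hv hθ0 hq hqq₁ hq₁t hκP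
  obtain ⟨C₁, -, hwt⟩ := hAB.exists_weak_type hμ hv hκ hP0 hPθ hκP k _ hk_weak.ne hk
  obtain ⟨C₂, hC₂⟩ : ∃ C₂ : ℝ≥0, α < β → θ⁻¹ ≤ (p₁⁻¹).toReal → ∀ s : ℝ,
      s⁻¹ = (α⁻¹).toReal - (β⁻¹).toReal → ∀ f : ℝ → ℝ≥0, AEMeasurable f μ → ∀ t : ℝ≥0, 0 < t →
      Amalgam.weight μ v θ {x | (t : ℝ≥0∞) < Amalgam.potential μ k f x} ^ (1 / θ) ≤
        C₂ * ((t : ℝ≥0∞)⁻¹ * Amalgam.fracNorm μ x₀ q₁ p₁ α₁ (fun x => f x * v x)) *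
          ((t : ℝ≥0∞)⁻¹ * Amalgam.fracNorm μ x₀ q ∞ α f) ^
            (s * ((q₁⁻¹).toReal - (α₁⁻¹).toReal)) := by
    -- The constant must be fixed before `s` and `f`. The exponents determine `s`, so a single
    -- constant serves; if the conditions on them fail, the claim is vacuous.
    by_cases hc : α < β ∧ θ⁻¹ ≤ (p₁⁻¹).toReal
    · obtain ⟨hlt, hp₁θ⟩ := hc
      set s := ((α⁻¹).toReal - (β⁻¹).toReal)⁻¹ with hs
      have hs0 : 0 < s := by
        refine inv_pos.2 (sub_pos.2 ?_)
        exact (ENNReal.toReal_lt_toReal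
          (by simpa using (one_pos.trans_le (hq.trans (hqα.trans hαβ))).ne')
          (by simpa using (one_pos.trans_le (hq.trans hqα)).ne')).2 (ENNReal.inv_lt_inv.2 hlt)
      have hp₁1 : 1 ≤ p₁ := hq₁1.trans (hq₁α₁.trans hα₁p₁)
      have hp₁t : p₁ ≠ ∞ := by
        rintro rfl
        simp only [ENNReal.inv_top, ENNReal.toReal_zero] at hp₁θ
        linarith
      have hp₁0 : 0 < p₁.toReal := ENNReal.toReal_pos (one_pos.trans_le hp₁1).ne' hp₁t
      obtain ⟨C₂, hC₂⟩ := Amalgam.exists_fracNorm_weak_type μ hμ x₀ (θ := θ) (s := s) (α := α) hκ hs0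
        (by rw [hs, inv_inv, one_div, hη]; ring) hq hqt hq₁1 hq₁t hq₁α₁ hp₁1 hp₁t
        (by rwa [ENNReal.toReal_inv, inv_le_inv₀ hθ0 hp₁0] at hp₁θ)
        (Amalgam.weight μ v θ) v k _ hk_weak.ne hk C₁ hwt
      refine ⟨C₂, fun _ _ s' hs' => ?_⟩
      rw [show s' = s by rw [hs, ← hs', inv_inv]]
      exact hC₂
    · exact ⟨0, fun h1 h2 => (hc ⟨h1, h2⟩).elim⟩
  refine ⟨C₁ + C₂, fun f hf t ht => ⟨?_, fun h1 h2 s hs => ?_⟩⟩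
  · rw [← Amalgam.weight_apply, Amalgam.eLpNorm_nnreal_eq_lintegral μ hq₁0 hq₁t]
    refine (hwt _ hf.coe_nnreal_ennreal t ht).trans ?_
    simp only [ENNReal.coe_mul]
    gcongr
    exact le_self_add
  · rw [← Amalgam.weight_apply]
    refine (hC₂ h1 h2 s hs f hf t ht).trans ?_
    gcongr
    exact le_add_self
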